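/- Let $(N,h)$ be a complete smooth Riemannian $n$-manifold with nonnegative curvature operator, and let $(M,g)$ be a complete noncompact smooth Riemannian manifold without boundary which is a warped product over $\mathbb{R}\times N$ or $\mathbb{R}^+\times N$. That is, for $J=\mathbb{R}$ or $J=\mathbb{R}^+=(0,\infty)$ there are a smooth function $f:J\to(0,\infty)$ and a diffeomorphism $\Phi$ of $J\times N$ onto an open subset of $M$ with $\Phi^*g=dr^2+f(r)^2h$, where (a) if $J=\mathbb{R}$, then $\Phi(J\times N)=M$; (b) if $J=\mathbb{R}^+$, then $\Phi(J\times N)=M\setminus\{o\}$ for a point $o\in M$ (the metric is closed up smoothly by one point; $dr^2+f(r)^2h$ on $(0,\infty)\times N$ alone is never complete). Let $\nabla r$ denote the image of $\partial_r$ under $\Phi$, and suppose that $\mathrm{Ric}_g(\nabla r,\nabla r)\ge -C^2$ on $\Phi(J\times N)$ for some constant $C\ge 0$. Then there is a constant $C'$ such that the curvature operator $R:\wedge^2T_xM\to\wedge^2T_xM$ of $g$ satisfies $R\ge -C'\,\mathrm{id}$, i.e. $\langle R\omega,\omega\rangle\ge -C'\langle\omega,\omega\rangle$ for all $x\in M$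 and all $\omega\in\wedge^2T_xM$. Here $\langle u\wedge v,w\wedge z\rangle=g(u,w)g(v,z)-g(u,z)g(v,w)$ and $\langle R(u\wedge v),w\wedge z\rangle=g(\nabla_u\nabla_v z-\nabla_v\nabla_u z-\nabla_{[u,v]}z,\,w)$. -/

import Mathlib

open Set Filter Topology
open scoped Manifold ContDiff ENNReal

noncomputable section

namespace RiemGeom

/-! ### Curvature of a metric on an open subset of a finite-dimensional vector space

A metric in coordinates is a map `G` from the coordinate space `E` to bilinear forms on `E`. -/

section Coordinates

variable {E : Type*} [NormedAddCommGroup E] [NormedSpace ℝ E]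

set_option maxSynthPendingDepth 3 in
/-- The bilinear map sending `u, v` to the covector
`w ↦ (1/2) (D_u G(v, w) + D_v G(u, w) - D_w G(u, v))` at the point `y`
(Christoffel symbols of the first kind). -/
def koszul (G : E → E →L[ℝ] E →L[ℝ] ℝ) (y : E) : E →L[ℝ] E →L[ℝ] E →L[ℝ] ℝ :=
  let A : E →L[ℝ] E →L[ℝ] E →L[ℝ] ℝ := fderiv ℝ G y
  let F : (E →L[ℝ] E →L[ℝ] ℝ) →L[ℝ] (E →L[ℝ] E →L[ℝ] ℝ) :=
    (ContinuousLinearMap.flipₗᵢ ℝ E E ℝ).toContinuousLinearEquiv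
  let B : E →L[ℝ] E →L[ℝ] E →L[ℝ] ℝ := F ∘L A.flip
  (1 / 2 : ℝ) • (A + A.flip - B)

set_option maxSynthPendingDepth 3 in
theorem koszul_apply (G : E → E →L[ℝ] E →L[ℝ] ℝ) (y u v w : E) :
    koszul G y u v w =
      (1 / 2 : ℝ) * (fderiv ℝ G y u v w + fderiv ℝ G y v u w - fderiv ℝ G y w u v) := by
  simp [koszul]

/-- The Levi-Civita connection in coordinates, `∇_u v = D_u v + Γ(u, v)`: the vector `Γ(u, v)`
is determined by `G(Γ(u, v), w) = koszul u v w` (Christoffel symbols of the second kind). -/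
def christoffel (G : E → E →L[ℝ] E →L[ℝ] ℝ) (y : E) : E →L[ℝ] E →L[ℝ] E :=
  ContinuousLinearMap.compL ℝ E (E →L[ℝ] ℝ) E (ContinuousLinearMap.inverse (G y)) ∘L koszul G y

theorem christoffel_apply (G : E → E →L[ℝ] E →L[ℝ] ℝ) (y u v : E) :
    christoffel G y u v = ContinuousLinearMap.inverse (G y) (koszul G y u v) := rfl

/-- The curvature endomorphism `R(u, v) = ∇_u ∇_v - ∇_v ∇_u - ∇_[u, v]` at the point `y`,
in coordinates. -/
def curvatureEndo (G : E → E →L[ℝ] E →L[ℝ] ℝ) (y u v : E) : E →L[ℝ] E :=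
  fderiv ℝ (christoffel G) y u v - fderiv ℝ (christoffel G) y v u
    + christoffel G y u ∘L christoffel G y v - christoffel G y v ∘L christoffel G y u

/-- `(u, v) ↦ R(u, v)` as an alternating map. -/
def curvatureAlt (G : E → E →L[ℝ] E →L[ℝ] ℝ) (y : E) : E [⋀^Fin 2]→ₗ[ℝ] (E →L[ℝ] E) where
  toFun m := curvatureEndo G y (m 0) (m 1)
  map_update_add' m i a b := by
    fin_cases i <;> ext w <;> simp [curvatureEndo] <;> abel
  map_update_smul' m i c a := by
    fin_cases i <;> ext w <;> simp [curvatureEndo, smul_sub, smul_add]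
  map_eq_zero_of_eq' m i j hij hne := by
    have h01 : m 0 = m 1 := by
      fin_cases i <;> fin_cases j <;> simp_all
    simp [curvatureEndo, h01]

end Coordinates

/-! ### Bivectors over a Euclidean vector space -/

section Bivectors

variable {E : Type*} [NormedAddCommGroup E] [NormedSpace ℝ E]

/-- The decomposable bivector `u ∧ v`. -/
def wedge (u v : E) : ⋀[ℝ]^2 E := exteriorPower.ιMulti ℝ 2 ![u, v]

/-- The bilinear form on bivectors induced by a bilinear form `b`:
`⟨u ∧ v, w ∧ z⟩ = b(u, w) b(v, z) - b(u, z) b(v, w)`. -/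
def bivectorForm (b : E →L[ℝ] E →L[ℝ] ℝ) : ⋀[ℝ]^2 E →ₗ[ℝ] ⋀[ℝ]^2 E →ₗ[ℝ] ℝ :=
  exteriorPower.pairingDual ℝ E 2 ∘ₗ
    exteriorPower.map 2 ((ContinuousLinearMap.coeLM ℝ).comp b.toLinearMap)

theorem bivectorForm_wedge (b : E →L[ℝ] E →L[ℝ] ℝ) (u v w z : E) :
    bivectorForm b (wedge u v) (wedge w z) = b u w * b v z - b u z * b v w := by
  simp only [bivectorForm, wedge, LinearMap.comp_apply, exteriorPower.map_apply_ιMulti]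
  rw [exteriorPower.pairingDual_ιMulti_ιMulti, Matrix.det_fin_two]
  simp
  ring

variable [FiniteDimensional ℝ E]

/-- The bivector of an endomorphism `A` that is skew with respect to the inner product `b`, i.e.
the bivector `θ` with `⟨θ, w ∧ z⟩ = b(A z, w)`; for an orthonormal basis `e` it is
`(1/2) ∑ i, A eᵢ ∧ eᵢ`. -/
def bivectorOfEndo (b : E →L[ℝ] E →L[ℝ] ℝ) : (E →L[ℝ] E) →ₗ[ℝ] ⋀[ℝ]^2 E where
  toFun A := (1 / 2 : ℝ) • ∑ i, wedge (A (Module.finBasis ℝ E i))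
    (ContinuousLinearMap.inverse b (LinearMap.toContinuousLinearMap ((Module.finBasis ℝ E).coord i)))
  map_add' A B := by
    have key (u u' v : E) : wedge (u + u') v = wedge u v + wedge u' v := by
      have h := (exteriorPower.ιMulti ℝ 2 (M := E)).map_update_add ![0, v] 0 u u'
      exact h
    simp only [add_apply, key, Finset.sum_add_distrib, smul_add]
  map_smul' c A := by
    have key (u v : E) : wedge (c • u) v = c • wedge u v := by
      have h := (exteriorPower.ιMulti ℝ 2 (M := E)).map_update_smul ![0, v] 0 c u
      exact h
    simp only [smul_apply, key, ← Finset.smul_sum, RingHom.id_apply]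
    rw [smul_comm]

theorem bivectorForm_bivectorOfEndo (b : E →L[ℝ] E →L[ℝ] ℝ)
    (hb : ∀ v, v ≠ 0 → 0 < b v v) (A : E →L[ℝ] E) (w z : E) :
    bivectorForm b (bivectorOfEndo b A) (wedge w z) = (1 / 2 : ℝ) * (b (A z) w - b (A w) z) := by
  have hinj : Function.Injective b := by
    rw [injective_iff_map_eq_zero]
    intro v hv
    by_contra hne
    have := hb v hne
    simp [hv] at this
  have hbij : Function.Bijective b := by
    refine ⟨hinj, ?_⟩
    have hd : Module.finrank ℝ E = Module.finrank ℝ (E →L[ℝ] ℝ) := by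
      rw [← (LinearMap.toContinuousLinearMap (𝕜 := ℝ) (E := E) (F' := ℝ)).finrank_eq]
      exact (Subspace.dual_finrank_eq (K := ℝ) (V := E)).symm
    exact (LinearMap.injective_iff_surjective_of_finrank_eq_finrank hd
      (f := b.toLinearMap)).1 hinj
  have hinv (l : E →L[ℝ] ℝ) : b (ContinuousLinearMap.inverse b l) = l := by
    let e : E ≃L[ℝ] (E →L[ℝ] ℝ) :=
      (LinearEquiv.ofBijective b.toLinearMap hbij).toContinuousLinearEquiv
    have he : (e : E →L[ℝ] (E →L[ℝ] ℝ)) = b := by ext; rfl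
    rw [← he, ContinuousLinearMap.inverse_equiv]
    exact e.apply_symm_apply l
  have hsum (x y : E) : ∑ i, b (A (Module.finBasis ℝ E i)) x * (Module.finBasis ℝ E).coord i y
      = b (A y) x := by
    conv_rhs => rw [← (Module.finBasis ℝ E).sum_repr y]
    simp only [map_sum, map_smul, sum_apply, smul_apply, smul_eq_mul, Module.Basis.coord_apply]
    exact Finset.sum_congr rfl fun i _ ↦ mul_comm _ _
  simp only [bivectorOfEndo, LinearMap.coe_mk, AddHom.coe_mk, map_smul, map_sum,
    LinearMap.smul_apply, LinearMap.sum_apply, bivectorForm_wedge, hinv, smul_eq_mul,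
    LinearMap.coe_toContinuousLinearMap', Finset.sum_sub_distrib, hsum]

end Bivectors

/-! ### Riemannian manifolds -/

section Manifolds

variable {E : Type*} [NormedAddCommGroup E] [NormedSpace ℝ E]
  {H : Type*} [TopologicalSpace H] {I : ModelWithCorners ℝ E H}
  {M : Type*} [TopologicalSpace M] [ChartedSpace H M] [IsManifold I ∞ M]

variable (I M) in
/-- Smooth Riemannian metrics on `M`. -/
abbrev RMetric : Type _ :=
  Bundle.ContMDiffRiemannianMetric (B := M) I ∞ E (fun x : M ↦ TangentSpace I x)

open scoped Bundle in
/-- The Riemannian distance: the infimum of the lengths of `C^1` paths. -/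
def riemDist (g : RMetric I M) (x y : M) : ℝ≥0∞ :=
  letI : Bundle.RiemannianBundle (fun x : M ↦ TangentSpace I x) := ⟨g.toRiemannianMetric⟩
  Manifold.riemannianEDist I x y

/-- The metric `g` is complete: Cauchy sequences for the Riemannian distance converge. -/
def IsCompleteMetric (g : RMetric I M) : Prop :=
  ∀ s : ℕ → M, (∀ ε : ℝ≥0∞, 0 < ε → ∃ K, ∀ m ≥ K, ∀ k ≥ K, riemDist g (s m) (s k) < ε) →
    ∃ x, Tendsto s atTop (𝓝 x)

/-- The inner product `g` on `T_x M`, which is by definition the space `E`. -/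
def metricAt (g : RMetric I M) (x : M) : E →L[ℝ] E →L[ℝ] ℝ := g.inner x

/-- The metric `g` in the preferred chart at `x`: the pull-back of `g` by the inverse chart. -/
def metricInChart (g : RMetric I M) (x : M) (y : E) : E →L[ℝ] E →L[ℝ] ℝ :=
  let D : E →L[ℝ] E := mfderiv 𝓘(ℝ, E) I (extChartAt I x).symm y
  (metricAt g ((extChartAt I x).symm y)).bilinearComp D D

/-- The preferred chart at `x` induces the identity from `T_x M` to `E`
(the space `T_x M` is by definition `E`), so there `metricInChart g x` is `g` itself. -/
theorem metricInChart_self [I.Boundaryless] (g : RMetric I M) (x : M) (u v : E) :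
    metricInChart g x (extChartAt I x x) u v = metricAt g x u v := by
  have h : mfderiv 𝓘(ℝ, E) I (extChartAt I x).symm (extChartAt I x x) =
      ContinuousLinearMap.id ℝ E := by
    have := mfderivWithin_range_extChartAt_symm (I := I) (x := x)
    rw [I.range_eq_univ, mfderivWithin_univ] at this
    exact this
  have hx : (extChartAt I x).symm (extChartAt I x x) = x := extChartAt_to_inv x
  have key : ∀ (x' : M) (_ : x' = x) (a b : E), metricAt g x' a b = metricAt g x a b := by
    rintro _ rfl _ _
    rfl
  simp only [metricInChart]
  rw [h]
  exact key _ hx u v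

/-- The curvature endomorphism `R(u, v) w = ∇_u ∇_v w - ∇_v ∇_u w - ∇_[u, v] w` of `T_x M`,
computed in the preferred chart at `x`, which identifies `T_x M` with `E` by the identity. -/
def curvature (g : RMetric I M) (x : M) (u v : E) : E →L[ℝ] E :=
  curvatureEndo (metricInChart g x) (extChartAt I x x) u v

/-- The Ricci curvature `Ric(u, v)`: the trace of the endomorphism `w ↦ R(w, u) v` of `T_x M`. -/
def ricci (g : RMetric I M) (x : M) (u v : E) : ℝ :=
  LinearMap.trace ℝ E
    { toFun := fun w ↦ curvature g x w u v
      map_add' := fun a b ↦ by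
        simp only [curvature, curvatureEndo, map_add, add_apply,
          sub_apply, ContinuousLinearMap.comp_apply]
        abel
      map_smul' := fun c a ↦ by
        simp only [curvature, curvatureEndo, map_smul, add_apply,
          sub_apply, ContinuousLinearMap.comp_apply,
          smul_apply, RingHom.id_apply, smul_sub, smul_add] }

variable [FiniteDimensional ℝ E]

/-- The curvature operator `R : ⋀² T_x M → ⋀² T_x M`: it sends `u ∧ v` to the bivector of the
skew endomorphism `R(u, v)`, so that `⟨R(u ∧ v), w ∧ z⟩ = g(R(u, v) z, w)`. -/
def curvatureOperator (g : RMetric I M) (x : M) : ⋀[ℝ]^2 E →ₗ[ℝ] ⋀[ℝ]^2 E :=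
  exteriorPower.alternatingMapLinearEquiv
    ((bivectorOfEndo (metricAt g x)).compAlternatingMap
      (curvatureAlt (metricInChart g x) (extChartAt I x x)))

/-- The value of the curvature operator on bivectors; the right-hand side is
`g(R(u, v) z, w)`, as `R(u, v)` is skew. -/
theorem bivectorForm_curvatureOperator (g : RMetric I M) (x : M) (u v w z : E) :
    bivectorForm (metricAt g x) (curvatureOperator g x (wedge u v)) (wedge w z) =
      (1 / 2 : ℝ) * (metricAt g x (curvature g x u v z) w - metricAt g x (curvature g x u v w) z) := by
  have h : curvatureOperator g x (wedge u v) =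
      bivectorOfEndo (metricAt g x) (curvature g x u v) := by
    simp only [curvatureOperator, wedge, exteriorPower.alternatingMapLinearEquiv_apply_ιMulti]
    rfl
  rw [h]
  exact bivectorForm_bivectorOfEndo (metricAt g x) (g.pos x) _ w z

/-- The curvature operator of `g` is bounded below by `κ • id` on all of `M`:
`⟨R θ, θ⟩ ≥ κ ⟨θ, θ⟩` for all bivectors `θ` at all points. -/
def CurvatureOperatorGE (g : RMetric I M) (κ : ℝ) : Prop :=
  ∀ (x : M) (θ : ⋀[ℝ]^2 E),
    κ * bivectorForm (metricAt g x) θ θ ≤ bivectorForm (metricAt g x) (curvatureOperator g x θ) θ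

end Manifolds

/-! ### Warped products -/

section Warped

variable {E : Type*} [NormedAddCommGroup E] [NormedSpace ℝ E]
  {H : Type*} [TopologicalSpace H] {I : ModelWithCorners ℝ E H}
  {M : Type*} [TopologicalSpace M] [ChartedSpace H M] [IsManifold I ∞ M]
  {E' : Type*} [NormedAddCommGroup E'] [NormedSpace ℝ E']
  {H' : Type*} [TopologicalSpace H'] {I' : ModelWithCorners ℝ E' H'}
  {N : Type*} [TopologicalSpace N] [ChartedSpace H' N] [IsManifold I' ∞ N]

/-- `Φ` is a diffeomorphism of `J × N` onto an open subset of `M`, and in the coordinates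
`(r, p) ∈ J × N` the metric `g` is the warped product `dr² + f(r)² h` with `f` smooth and positive
on the open set `J` of real numbers. -/
structure IsWarpedProduct (g : RMetric I M) (h : RMetric I' N) (f : ℝ → ℝ) (J : Set ℝ)
    (Φ : OpenPartialHomeomorph (ℝ × N) M) : Prop where
  smooth_warp : ContDiffOn ℝ ∞ f J
  warp_pos : ∀ r ∈ J, 0 < f r
  source_eq : Φ.source = J ×ˢ (univ : Set N)
  smooth : ContMDiffOn (𝓘(ℝ, ℝ).prod I') I ∞ Φ Φ.source
  smooth_symm : ContMDiffOn I (𝓘(ℝ, ℝ).prod I') ∞ Φ.symm Φ.target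
  metric_eq : ∀ r ∈ J, ∀ p : N, ∀ (a b : ℝ) (v w : E'),
    g.inner (Φ (r, p)) (mfderiv (𝓘(ℝ, ℝ).prod I') I Φ (r, p) ((a, v) : ℝ × E'))
        (mfderiv (𝓘(ℝ, ℝ).prod I') I Φ (r, p) ((b, w) : ℝ × E')) =
      a * b + f r ^ 2 * h.inner p v w

variable (I I') in
/-- The radial vector `∇r` at the point `Φ(r, p)`: the image of `∂/∂r`. -/
def radial (Φ : OpenPartialHomeomorph (ℝ × N) M) (r : ℝ) (p : N) : TangentSpace I (Φ (r, p)) :=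
  mfderiv (𝓘(ℝ, ℝ).prod I') I Φ (r, p) ((1 : ℝ), (0 : E'))

end Warped

end RiemGeom

end

/-!
# Warped products with radial Ricci curvature bounded below

Write `n = dim N`, let `R_N` be the curvature operator of `h`, and split a bivector at a point of
`J × N` into a part `dr ∧ w` and a part `η` tangent to `N`. For `g = dr² + f² h` the curvature
operator respects the splitting (`curvatureForm_warpedMetric`):

  `⟨R θ, θ⟩ = -f f'' |w|² + f² (⟨R_N η, η⟩ - f'² |η|²)`,  `⟨θ, θ⟩ = f² |w|² + f⁴ |η|²`,

where `w` and `η` are measured by `h`, and `Ric(∇r, ∇r) = -n f'' / f`. So the hypothesis says that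
`f'' ≤ k² f` with `k² = C² / n`, and a bound `R ≥ -C'` holds with `C' ≥ k²` as soon as
`R_N ≥ f'² - C' f²` (`curvatureGEAt_warpedMetric`). As `R_N ≥ 0`, this is clear where `|f'| ≤ k f`.

The inequality `f'' ≤ k² f` makes `e^{kr} (f' - k f)` and `e^{-kr} (f' + k f)` decreasing. A
positive function on a half-line `[r₀, ∞)` therefore satisfies `f' ≥ -k f`, as otherwise it would
reach zero. On the whole line the reflected argument gives `|f'| ≤ k f` everywhere, which settles
the case `J = ℝ`.

On `(0, ∞)` the bound `f' ≤ k f` may fail at a point `r`. Then `f' > k f` on all of `(0, r)`, so that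
`f` increases and `f'² - k² f²` decreases there (`sq_deriv_le_or_of_Ioi`), and it is enough to bound
`R_N` below by `f'² - C₁ f²` at one point `s < r` of each radial curve. This bound is the curvature
formula read backwards (`CurvatureGEAt.fibre`), at a point where `R ≥ -C₁`. Such a `C₁` exists on a
neighbourhood of the apex `o`, because the curvature is continuous there
(`eventually_curvatureGEAt`), and completeness forces every radial curve to converge to `o` as
`r → 0` (`IsWarpedProduct.tendsto_apex`). The constant `C₁` does not depend on the curve.

The curvature at a point is defined in the preferred chart at that point. It is compared between
points, and computed for the warped product, by means of the naturality of the curvature under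
changes of coordinates (`curvatureEndo_pullback`), which follows from the transformation law of the
Christoffel symbols.
-/

noncomputable section

namespace RiemGeom

/-! ### Naturality of the curvature under changes of coordinates -/

section Coordinates

-- needed for the normed space structure on iterated spaces of continuous linear maps
set_option maxSynthPendingDepth 3

variable {E : Type*} [NormedAddCommGroup E] [NormedSpace ℝ E]
  {F : Type*} [NormedAddCommGroup F] [NormedSpace ℝ F]

/-- The bilinear form `b` is an inner product: symmetric and positive definite. -/
structure IsInner (b : E →L[ℝ] E →L[ℝ] ℝ) : Prop where
  symm : ∀ u v, b u v = b v u
  pos : ∀ v, v ≠ 0 → 0 < b v v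

theorem IsInner.injective {b : E →L[ℝ] E →L[ℝ] ℝ} (hb : IsInner b) : Function.Injective b := by
  rw [injective_iff_map_eq_zero]
  intro v hv
  by_contra hne
  have := hb.pos v hne
  simp [hv] at this

theorem IsInner.eq_of_forall {b : E →L[ℝ] E →L[ℝ] ℝ} (hb : IsInner b) {u v : E}
    (h : ∀ w, b u w = b v w) : u = v :=
  hb.injective (by ext w; exact h w)

theorem IsInner.nonneg {b : E →L[ℝ] E →L[ℝ] ℝ} (hb : IsInner b) (v : E) : 0 ≤ b v v := by
  rcases eq_or_ne v 0 with rfl | hv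
  · simp
  · exact (hb.pos v hv).le

theorem IsInner.isInvertible [FiniteDimensional ℝ E] {b : E →L[ℝ] E →L[ℝ] ℝ} (hb : IsInner b) :
    b.IsInvertible := by
  have hd : Module.finrank ℝ E = Module.finrank ℝ (E →L[ℝ] ℝ) := by
    rw [← (LinearMap.toContinuousLinearMap (𝕜 := ℝ) (E := E) (F' := ℝ)).finrank_eq]
    exact (Subspace.dual_finrank_eq (K := ℝ) (V := E)).symm
  have hbij : Function.Bijective b.toLinearMap := ⟨hb.injective,
    (LinearMap.injective_iff_surjective_of_finrank_eq_finrank hd (f := b.toLinearMap)).1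
      hb.injective⟩
  exact ⟨(LinearEquiv.ofBijective b.toLinearMap hbij).toContinuousLinearEquiv, by ext; rfl⟩

theorem IsInner.bilinearComp {b : E →L[ℝ] E →L[ℝ] ℝ} (hb : IsInner b) {D : F →L[ℝ] E}
    (hD : Function.Injective D) : IsInner (b.bilinearComp D D) where
  symm _ _ := hb.symm _ _
  pos _ hv := hb.pos _ fun h ↦ hv (hD (h.trans (map_zero D).symm))

/-- The defining property of the Christoffel symbols of the second kind. -/
theorem apply_christoffel [FiniteDimensional ℝ E] {G : E → E →L[ℝ] E →L[ℝ] ℝ} {y : E}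
    (hG : IsInner (G y)) (u v w : E) : G y (christoffel G y u v) w = koszul G y u v w := by
  rw [christoffel_apply, hG.isInvertible.self_apply_inverse]

theorem christoffel_congr {G G' : E → E →L[ℝ] E →L[ℝ] ℝ} {y : E} (h : G =ᶠ[𝓝 y] G') :
    christoffel G =ᶠ[𝓝 y] christoffel G' := by
  filter_upwards [h.eventually_nhds] with z hz
  have hz' : fderiv ℝ G z = fderiv ℝ G' z := Filter.EventuallyEq.fderiv_eq hz
  simp only [christoffel, koszul, hz', hz.self_of_nhds]

theorem curvatureEndo_congr {G G' : E → E →L[ℝ] E →L[ℝ] ℝ} {y : E} (h : G =ᶠ[𝓝 y] G') :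
    curvatureEndo G y = curvatureEndo G' y := by
  have h1 := christoffel_congr h
  funext u v
  simp only [curvatureEndo, h1.fderiv_eq, h1.self_of_nhds]

theorem contDiffAt_koszul {G : E → E →L[ℝ] E →L[ℝ] ℝ} {y : E} {n : WithTop ℕ∞}
    (hG : ContDiffAt ℝ (n + 1) G y) : ContDiffAt ℝ n (koszul G) y := by
  have hA : ContDiffAt ℝ n (fderiv ℝ G) y := hG.fderiv_right le_rfl
  have hB : ContDiffAt ℝ n (fun z ↦ (fderiv ℝ G z).flip) y :=
    ((ContinuousLinearMap.flipₗᵢ ℝ E E (E →L[ℝ] ℝ)).contDiff.contDiffAt).comp y hA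
  unfold koszul
  exact ((hA.add hB).sub (contDiffAt_const.clm_comp hB)).const_smul (1 / 2 : ℝ)

theorem contDiffAt_christoffel [FiniteDimensional ℝ E] {G : E → E →L[ℝ] E →L[ℝ] ℝ} {y : E}
    {n : WithTop ℕ∞} (hG : ContDiffAt ℝ (n + 1) G y) (hi : IsInner (G y)) :
    ContDiffAt ℝ n (christoffel G) y := by
  have : CompleteSpace E := FiniteDimensional.complete ℝ E
  have h1 : ContDiffAt ℝ n (fun z ↦ ContinuousLinearMap.inverse (G z)) y :=
    (hi.isInvertible.contDiffAt_map_inverse).comp y (hG.of_le le_self_add)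
  have h2 : ContDiffAt ℝ n (fun z ↦
      ContinuousLinearMap.compL ℝ E (E →L[ℝ] ℝ) E (ContinuousLinearMap.inverse (G z))) y :=
    (ContinuousLinearMap.contDiff _).contDiffAt.comp y h1
  exact h2.clm_comp (contDiffAt_koszul hG)

theorem contDiffAt_bilinearComp {n : WithTop ℕ∞} {G : E → F →L[ℝ] F →L[ℝ] ℝ} {D : E → E →L[ℝ] F}
    {y : E} (hG : ContDiffAt ℝ n G y) (hD : ContDiffAt ℝ n D y) :
    ContDiffAt ℝ n (fun z ↦ (G z).bilinearComp (D z) (D z)) y := by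
  have h1 : ContDiffAt ℝ n (fun z ↦ ((G z).comp (D z)).flip) y :=
    ((ContinuousLinearMap.flipₗᵢ ℝ E F ℝ).contDiff.contDiffAt).comp y (hG.clm_comp hD)
  exact ((ContinuousLinearMap.flipₗᵢ ℝ E E ℝ).contDiff.contDiffAt).comp y (h1.clm_comp hD)

/-- The transformation law of the Christoffel symbols under a change of coordinates. -/
theorem christoffel_pullback [FiniteDimensional ℝ E] [FiniteDimensional ℝ F]
    {G : F → F →L[ℝ] F →L[ℝ] ℝ} {G' : E → E →L[ℝ] E →L[ℝ] ℝ} {φ : E → F} {y : E}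
    (hφ : ContDiffAt ℝ 2 φ y) (hinv : Function.Bijective (fderiv ℝ φ y))
    (hG : ContDiffAt ℝ 1 G (φ y)) (hi : IsInner (G (φ y)))
    (hG' : G' =ᶠ[𝓝 y] fun z ↦ (G (φ z)).bilinearComp (fderiv ℝ φ z) (fderiv ℝ φ z)) (u v : E) :
    fderiv ℝ φ y (christoffel G' y u v) =
      fderiv ℝ (fderiv ℝ φ) y u v + christoffel G (φ y) (fderiv ℝ φ y u) (fderiv ℝ φ y v) := by
  have hφ1 : DifferentiableAt ℝ φ y := hφ.differentiableAt two_ne_zero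
  have hφ2 : DifferentiableAt ℝ (fderiv ℝ φ) y :=
    (hφ.fderiv_right (m := 1) (by norm_num)).differentiableAt one_ne_zero
  have hsymm : ∀ a b, fderiv ℝ (fderiv ℝ φ) y a b = fderiv ℝ (fderiv ℝ φ) y b a := fun a b ↦
    (hφ.isSymmSndFDerivAt (by simp)) a b
  have hy : G' y = (G (φ y)).bilinearComp (fderiv ℝ φ y) (fderiv ℝ φ y) := hG'.self_of_nhds
  have hi' : IsInner (G' y) := hy ▸ hi.bilinearComp hinv.1
  have hder (a b c : E) : fderiv ℝ G' y a b c =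
      fderiv ℝ G (φ y) (fderiv ℝ φ y a) (fderiv ℝ φ y b) (fderiv ℝ φ y c)
      + G (φ y) (fderiv ℝ (fderiv ℝ φ) y a b) (fderiv ℝ φ y c)
      + G (φ y) (fderiv ℝ φ y b) (fderiv ℝ (fderiv ℝ φ) y a c) := by
    have hd : DifferentiableAt ℝ G' y := by
      refine DifferentiableAt.congr_of_eventuallyEq ?_ hG'
      exact (contDiffAt_bilinearComp (hG.comp y (hφ.of_le (by norm_num)))
        (hφ.fderiv_right (m := 1) (by norm_num))).differentiableAt one_ne_zero
    have h1 : HasFDerivAt (fun z ↦ G' z b c) ((fderiv ℝ G' y).flip b |>.flip c) y := by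
      simpa using (hd.hasFDerivAt.clm_apply (hasFDerivAt_const b y)).clm_apply
        (hasFDerivAt_const c y)
    have h2 : HasFDerivAt (fun z ↦ G (φ z) (fderiv ℝ φ z b) (fderiv ℝ φ z c)) _ y :=
      (((hG.differentiableAt one_ne_zero).hasFDerivAt.comp y hφ1.hasFDerivAt).clm_apply
        (hφ2.hasFDerivAt.clm_apply (hasFDerivAt_const b y))).clm_apply
        (hφ2.hasFDerivAt.clm_apply (hasFDerivAt_const c y))
    have h3 : (fun z ↦ G' z b c) =ᶠ[𝓝 y] fun z ↦ G (φ z) (fderiv ℝ φ z b) (fderiv ℝ φ z c) := by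
      filter_upwards [hG'] with z hz
      rw [hz]; rfl
    have h4 := congrArg (fun l ↦ l a) (h1.unique (h2.congr_of_eventuallyEq h3))
    simp at h4
    rw [h4]
    ring
  refine hi.eq_of_forall fun w' ↦ ?_
  obtain ⟨w, rfl⟩ := hinv.2 w'
  have hl : G (φ y) (fderiv ℝ φ y (christoffel G' y u v)) (fderiv ℝ φ y w) =
      koszul G' y u v w := by
    rw [← apply_christoffel hi', hy]; rfl
  rw [hl, map_add, add_apply, apply_christoffel hi, koszul_apply, koszul_apply]
  simp only [hder]
  rw [hsymm w u, hsymm w v, hsymm v u, hi.symm (fderiv ℝ φ y v),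
    hi.symm (fderiv ℝ φ y u) (fderiv ℝ (fderiv ℝ φ) y v w)]
  ring

/-- The curvature endomorphism is a tensor: it is natural under changes of coordinates. -/
theorem curvatureEndo_pullback [FiniteDimensional ℝ E] [FiniteDimensional ℝ F]
    {G : F → F →L[ℝ] F →L[ℝ] ℝ} {G' : E → E →L[ℝ] E →L[ℝ] ℝ} {φ : E → F} {y : E}
    (hφ : ContDiffAt ℝ 3 φ y) (hinv : (fderiv ℝ φ y).IsInvertible)
    (hG : ContDiffAt ℝ 2 G (φ y)) (hi : ∀ᶠ z in 𝓝 (φ y), IsInner (G z))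
    (hG' : G' =ᶠ[𝓝 y] fun z ↦ (G (φ z)).bilinearComp (fderiv ℝ φ z) (fderiv ℝ φ z)) (u v w : E) :
    fderiv ℝ φ y (curvatureEndo G' y u v w) =
      curvatureEndo G (φ y) (fderiv ℝ φ y u) (fderiv ℝ φ y v) (fderiv ℝ φ y w) := by
  have : CompleteSpace E := FiniteDimensional.complete ℝ E
  have hφc : ContinuousAt φ y := hφ.continuousAt
  have hφ1 : DifferentiableAt ℝ φ y := hφ.differentiableAt (by norm_num)
  have hφ' : ContDiffAt ℝ 2 (fderiv ℝ φ) y := hφ.fderiv_right (m := 2) (by norm_num)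
  have hφ'' : ContDiffAt ℝ 1 (fderiv ℝ (fderiv ℝ φ)) y := hφ'.fderiv_right (m := 1) (by norm_num)
  have hφ2 : DifferentiableAt ℝ (fderiv ℝ φ) y := hφ'.differentiableAt (by norm_num)
  have hφ3 : DifferentiableAt ℝ (fderiv ℝ (fderiv ℝ φ)) y := hφ''.differentiableAt one_ne_zero
  have hsymm3 : ∀ a b, fderiv ℝ (fderiv ℝ (fderiv ℝ φ)) y a b =
      fderiv ℝ (fderiv ℝ (fderiv ℝ φ)) y b a := fun a b ↦ (hφ'.isSymmSndFDerivAt (by simp)) a b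
  have hsymm : ∀ a b, fderiv ℝ (fderiv ℝ φ) y a b = fderiv ℝ (fderiv ℝ φ) y b a := fun a b ↦
    ((hφ.of_le (m := 2) (by norm_num)).isSymmSndFDerivAt (by simp)) a b
  have hinv' : ∀ᶠ z in 𝓝 y, Function.Bijective (fderiv ℝ φ z) := by
    obtain ⟨e, he⟩ := hinv
    have := hφ2.continuousAt.eventually_mem (he ▸ ContinuousLinearEquiv.nhds e)
    filter_upwards [this] with z hz
    obtain ⟨e', he'⟩ := hz
    rw [← he']
    exact e'.bijective
  have hGn : ∀ᶠ z in 𝓝 (φ y), ContDiffAt ℝ 2 G z := hG.eventually (by simp)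
  have hlaw (a b : E) : ∀ᶠ z in 𝓝 y, fderiv ℝ φ z (christoffel G' z a b) =
      fderiv ℝ (fderiv ℝ φ) z a b + christoffel G (φ z) (fderiv ℝ φ z a) (fderiv ℝ φ z b) := by
    filter_upwards [hinv', hφc.eventually hGn, hφc.eventually hi, hG'.eventually_nhds,
      hφ.eventually (by simp)] with z h1 h2 h3 h4 h5
    exact christoffel_pullback (h5.of_le (by norm_num)) h1 (h2.of_le (by norm_num)) h3 h4 a b
  have hΓ : DifferentiableAt ℝ (christoffel G) (φ y) :=
    (contDiffAt_christoffel (n := 1) (hG.of_le (by norm_num)) hi.self_of_nhds).differentiableAt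
      one_ne_zero
  have hΓ' : DifferentiableAt ℝ (christoffel G') y := by
    have h1 : ContDiffAt ℝ 2 G' y :=
      (contDiffAt_bilinearComp (hG.comp y (hφ.of_le (by norm_num))) hφ').congr_of_eventuallyEq hG'
    have h2 : IsInner (G' y) := by
      rw [hG'.self_of_nhds]
      exact hi.self_of_nhds.bilinearComp hinv.injective
    exact (contDiffAt_christoffel (n := 1) (h1.of_le (by norm_num)) h2).differentiableAt one_ne_zero
  -- the derivative of the transformation law of the Christoffel symbols
  have hder (a b c : E) : fderiv ℝ φ y (fderiv ℝ (christoffel G') y a b c) =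
      fderiv ℝ (fderiv ℝ (fderiv ℝ φ)) y a b c
      + fderiv ℝ (christoffel G) (φ y) (fderiv ℝ φ y a) (fderiv ℝ φ y b) (fderiv ℝ φ y c)
      + christoffel G (φ y) (fderiv ℝ (fderiv ℝ φ) y a b) (fderiv ℝ φ y c)
      + christoffel G (φ y) (fderiv ℝ φ y b) (fderiv ℝ (fderiv ℝ φ) y a c)
      - fderiv ℝ (fderiv ℝ φ) y a (christoffel G' y b c) := by
    have h1 : HasFDerivAt (fun z ↦ fderiv ℝ φ z (christoffel G' z b c)) _ y :=
      hφ2.hasFDerivAt.clm_apply ((hΓ'.hasFDerivAt.clm_apply (hasFDerivAt_const b y)).clm_apply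
        (hasFDerivAt_const c y))
    have h2 : HasFDerivAt (fun z ↦ fderiv ℝ (fderiv ℝ φ) z b c +
        christoffel G (φ z) (fderiv ℝ φ z b) (fderiv ℝ φ z c)) _ y :=
      ((hφ3.hasFDerivAt.clm_apply (hasFDerivAt_const b y)).clm_apply (hasFDerivAt_const c y)).add
      (((hΓ.hasFDerivAt.comp y hφ1.hasFDerivAt).clm_apply
        (hφ2.hasFDerivAt.clm_apply (hasFDerivAt_const b y))).clm_apply
        (hφ2.hasFDerivAt.clm_apply (hasFDerivAt_const c y)))
    have h4 := congrArg (fun l ↦ l a) (h1.unique (h2.congr_of_eventuallyEq (hlaw b c)))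
    simp at h4
    rw [eq_sub_iff_add_eq, h4]
    abel
  have h0 (a b : E) := (hlaw a b).self_of_nhds
  simp only [curvatureEndo, sub_apply, add_apply, ContinuousLinearMap.comp_apply, map_add, map_sub,
    hder, h0]
  -- the second and third derivatives of `φ` drop out when `u` and `v` are antisymmetrized
  rw [hsymm3 v u, hsymm v u]
  abel

end Coordinates

/-! ### The curvature of a warped product in coordinates -/

section WarpedCoordinates

set_option maxSynthPendingDepth 3

variable {E : Type*} [NormedAddCommGroup E] [NormedSpace ℝ E]

theorem differentiableAt_deriv {f : ℝ → ℝ} {r : ℝ} (hf : ContDiffAt ℝ 2 f r) :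
    DifferentiableAt ℝ (deriv f) r := by
  have h1 : ContDiffAt ℝ 1 (fderiv ℝ f) r := hf.fderiv_right (by norm_num)
  have h2 : DifferentiableAt ℝ (fun x ↦ fderiv ℝ f x 1) r :=
    (h1.differentiableAt one_ne_zero).clm_apply (differentiableAt_const _)
  simpa only [fderiv_apply_one_eq_deriv] using h2

/-- The warped product `dr² + f(r)² H` on `ℝ × E`, in coordinates. -/
def warpedMetric (f : ℝ → ℝ) (H : E → E →L[ℝ] E →L[ℝ] ℝ) (z : ℝ × E) :
    (ℝ × E) →L[ℝ] (ℝ × E) →L[ℝ] ℝ :=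
  (ContinuousLinearMap.mul ℝ ℝ).bilinearComp (.fst ℝ ℝ E) (.fst ℝ ℝ E)
    + f z.1 ^ 2 • (H z.2).bilinearComp (.snd ℝ ℝ E) (.snd ℝ ℝ E)

@[simp]
theorem warpedMetric_apply (f : ℝ → ℝ) (H : E → E →L[ℝ] E →L[ℝ] ℝ) (z X Y : ℝ × E) :
    warpedMetric f H z X Y = X.1 * Y.1 + f z.1 ^ 2 * H z.2 X.2 Y.2 := rfl

theorem isInner_warpedMetric {f : ℝ → ℝ} {H : E → E →L[ℝ] E →L[ℝ] ℝ} {z : ℝ × E}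
    (hf : 0 < f z.1) (hH : IsInner (H z.2)) : IsInner (warpedMetric f H z) where
  symm X Y := by simp [mul_comm X.1, hH.symm X.2]
  pos X hX := by
    rw [warpedMetric_apply]
    by_cases h2 : X.2 = 0
    · have h1 : X.1 ≠ 0 := fun h1 ↦ hX (Prod.ext h1 h2)
      simp only [h2, map_zero, mul_zero, add_zero]
      exact mul_self_pos.2 h1
    · exact add_pos_of_nonneg_of_pos (mul_self_nonneg _) (mul_pos (pow_pos hf 2) (hH.pos _ h2))

theorem contDiffAt_warpedMetric {f : ℝ → ℝ} {H : E → E →L[ℝ] E →L[ℝ] ℝ} {z : ℝ × E}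
    {n : WithTop ℕ∞} (hf : ContDiffAt ℝ n f z.1) (hH : ContDiffAt ℝ n H z.2) :
    ContDiffAt ℝ n (warpedMetric f H) z := by
  have h1 : ContDiffAt ℝ n (fun z : ℝ × E ↦ f z.1 ^ 2) z := (hf.comp z contDiffAt_fst).pow 2
  have h2 : ContDiffAt ℝ n (fun z : ℝ × E ↦ H z.2) z := hH.comp z contDiffAt_snd
  have h3 : ContDiffAt ℝ n
      (fun z : ℝ × E ↦ (H z.2).bilinearComp (.snd ℝ ℝ E) (.snd ℝ ℝ E)) z :=
    contDiffAt_bilinearComp h2 contDiffAt_const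
  exact contDiffAt_const.add (h1.smul h3)

theorem fderiv_warpedMetric {f : ℝ → ℝ} {H : E → E →L[ℝ] E →L[ℝ] ℝ} {z : ℝ × E}
    (hf : ContDiffAt ℝ 1 f z.1) (hH : ContDiffAt ℝ 1 H z.2) (U V W : ℝ × E) :
    fderiv ℝ (warpedMetric f H) z U V W =
      2 * f z.1 * deriv f z.1 * U.1 * H z.2 V.2 W.2 + f z.1 ^ 2 * fderiv ℝ H z.2 U.2 V.2 W.2 := by
  have h1 : HasFDerivAt (fun z ↦ warpedMetric f H z V W)
      ((fderiv ℝ (warpedMetric f H) z).flip V |>.flip W) z := by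
    simpa using (((contDiffAt_warpedMetric hf hH).differentiableAt one_ne_zero).hasFDerivAt.clm_apply
      (hasFDerivAt_const V z)).clm_apply (hasFDerivAt_const W z)
  have hfst : HasFDerivAt (Prod.fst : ℝ × E → ℝ) (.fst ℝ ℝ E) z := hasFDerivAt_fst
  have hf' : HasFDerivAt (fun z : ℝ × E ↦ f z.1) _ z :=
    ((hf.differentiableAt one_ne_zero).hasDerivAt).comp_hasFDerivAt z hfst
  have hH' : HasFDerivAt (fun z : ℝ × E ↦ H z.2) _ z :=
    (hH.differentiableAt one_ne_zero).hasFDerivAt.comp z hasFDerivAt_snd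
  have h2 : HasFDerivAt (fun z : ℝ × E ↦ V.1 * W.1 + f z.1 ^ 2 * H z.2 V.2 W.2) _ z :=
    (hasFDerivAt_const _ z).add ((hf'.pow 2).mul ((hH'.clm_apply (hasFDerivAt_const V.2 z)).clm_apply
      (hasFDerivAt_const W.2 z)))
  have h4 := congrArg (fun l ↦ l U) (h1.unique h2)
  simp at h4
  rw [h4]
  ring

variable [FiniteDimensional ℝ E]

theorem christoffel_warpedMetric {f : ℝ → ℝ} {H : E → E →L[ℝ] E →L[ℝ] ℝ} {z : ℝ × E}
    (hf : ContDiffAt ℝ 1 f z.1) (hH : ContDiffAt ℝ 1 H z.2) (hpos : 0 < f z.1)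
    (hi : IsInner (H z.2)) (X Y : ℝ × E) :
    christoffel (warpedMetric f H) z X Y =
      (-(f z.1 * deriv f z.1) * H z.2 X.2 Y.2,
        christoffel H z.2 X.2 Y.2 + (deriv f z.1 / f z.1) • (X.1 • Y.2 + Y.1 • X.2)) := by
  have hG := isInner_warpedMetric hpos hi
  refine hG.eq_of_forall fun W ↦ ?_
  rw [apply_christoffel hG, koszul_apply]
  simp only [fderiv_warpedMetric hf hH, warpedMetric_apply, map_add, map_smul, add_apply, smul_apply,
    apply_christoffel hi, koszul_apply, smul_eq_mul]
  field_simp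
  ring

/-- The curvature of a warped product in coordinates. -/
theorem curvatureEndo_warpedMetric {f : ℝ → ℝ} {H : E → E →L[ℝ] E →L[ℝ] ℝ} {z : ℝ × E}
    (hf : ContDiffAt ℝ 2 f z.1) (hH : ContDiffAt ℝ 2 H z.2) (hpos : 0 < f z.1)
    (hi : ∀ᶠ y in 𝓝 z.2, IsInner (H y)) (X Y Z : ℝ × E) :
    curvatureEndo (warpedMetric f H) z X Y Z =
      (-(f z.1 * deriv (deriv f) z.1) * (X.1 * H z.2 Y.2 Z.2 - Y.1 * H z.2 X.2 Z.2),
        curvatureEndo H z.2 X.2 Y.2 Z.2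
          + (deriv (deriv f) z.1 / f z.1 * Z.1) • (X.1 • Y.2 - Y.1 • X.2)
          - deriv f z.1 ^ 2 • (H z.2 Y.2 Z.2 • X.2 - H z.2 X.2 Z.2 • Y.2)) := by
  have hiz := hi.self_of_nhds
  have hfst : HasFDerivAt (Prod.fst : ℝ × E → ℝ) (.fst ℝ ℝ E) z := hasFDerivAt_fst
  have hf1 : DifferentiableAt ℝ f z.1 := hf.differentiableAt (by norm_num)
  have hf2 : DifferentiableAt ℝ (deriv f) z.1 := differentiableAt_deriv hf
  have hH1 : DifferentiableAt ℝ H z.2 := hH.differentiableAt (by norm_num)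
  have hΓ : DifferentiableAt ℝ (christoffel H) z.2 :=
    (contDiffAt_christoffel (n := 1) (hH.of_le (by norm_num)) hiz).differentiableAt one_ne_zero
  have hΓG : DifferentiableAt ℝ (christoffel (warpedMetric f H)) z :=
    (contDiffAt_christoffel (n := 1) ((contDiffAt_warpedMetric hf hH).of_le (by norm_num))
      (isInner_warpedMetric hpos hiz)).differentiableAt one_ne_zero
  have hlaw (A B : ℝ × E) : (fun y ↦ christoffel (warpedMetric f H) y A B) =ᶠ[𝓝 z] fun y ↦
      (-(f y.1 * deriv f y.1) * H y.2 A.2 B.2,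
        christoffel H y.2 A.2 B.2 + (deriv f y.1 / f y.1) • (A.1 • B.2 + B.1 • A.2)) := by
    have hc1 : ContinuousAt Prod.fst z := continuousAt_fst
    have hc2 : ContinuousAt Prod.snd z := continuousAt_snd
    filter_upwards [hc1.eventually (hf.eventually (by simp)), hc2.eventually (hH.eventually (by simp)),
      hc2.eventually hi, hc1.eventually (hf.continuousAt.eventually (lt_mem_nhds hpos))]
      with y h1 h2 h3 h4
    exact christoffel_warpedMetric (h1.of_le (by norm_num)) (h2.of_le (by norm_num)) h4 h3 A B
  -- the derivative of the Christoffel symbols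
  have hder (A B C : ℝ × E) : fderiv ℝ (christoffel (warpedMetric f H)) z A B C =
      (-(deriv f z.1 ^ 2 + f z.1 * deriv (deriv f) z.1) * A.1 * H z.2 B.2 C.2
          - f z.1 * deriv f z.1 * fderiv ℝ H z.2 A.2 B.2 C.2,
        fderiv ℝ (christoffel H) z.2 A.2 B.2 C.2
          + ((deriv (deriv f) z.1 / f z.1 - deriv f z.1 ^ 2 / f z.1 ^ 2) * A.1) •
            (B.1 • C.2 + C.1 • B.2)) := by
    have h1 : HasFDerivAt (fun y ↦ christoffel (warpedMetric f H) y B C) _ z :=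
      (hΓG.hasFDerivAt.clm_apply (hasFDerivAt_const B z)).clm_apply (hasFDerivAt_const C z)
    have hp : HasFDerivAt (fun y : ℝ × E ↦ -(f y.1 * deriv f y.1)) _ z :=
      HasDerivAt.comp_hasFDerivAt (h₂ := fun r ↦ -(f r * deriv f r)) z
        (hf1.hasDerivAt.mul hf2.hasDerivAt).neg hfst
    have hq : HasFDerivAt (fun y : ℝ × E ↦ deriv f y.1 / f y.1) _ z :=
      HasDerivAt.comp_hasFDerivAt (h₂ := fun r ↦ deriv f r / f r) z
        (hf2.hasDerivAt.div hf1.hasDerivAt hpos.ne') hfst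
    have hH' : HasFDerivAt (fun y : ℝ × E ↦ H y.2 B.2 C.2) _ z :=
      ((hH1.hasFDerivAt.comp z hasFDerivAt_snd).clm_apply (hasFDerivAt_const B.2 z)).clm_apply
        (hasFDerivAt_const C.2 z)
    have hΓ' : HasFDerivAt (fun y : ℝ × E ↦ christoffel H y.2 B.2 C.2) _ z :=
      ((hΓ.hasFDerivAt.comp z hasFDerivAt_snd).clm_apply (hasFDerivAt_const B.2 z)).clm_apply
        (hasFDerivAt_const C.2 z)
    have h2 := (hp.mul hH').prodMk (hΓ'.add (hq.smul_const (B.1 • C.2 + C.1 • B.2)))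
    have h4 := congrArg (fun l ↦ l A) (h1.unique (h2.congr_of_eventuallyEq (hlaw B C)))
    simp at h4
    rw [h4]
    ext
    · simp; ring
    · simp
      congr 2 <;> field_simp
  have h0 (A B : ℝ × E) : christoffel (warpedMetric f H) z A B = _ := (hlaw A B).self_of_nhds
  have hsm (c a b : E) : fderiv ℝ H z.2 c a b = fderiv ℝ H z.2 c b a := by
    have h1 (a b : E) : HasFDerivAt (fun y ↦ H y a b) ((fderiv ℝ H z.2).flip a |>.flip b) z.2 := by
      simpa using (hH1.hasFDerivAt.clm_apply (hasFDerivAt_const a z.2)).clm_apply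
        (hasFDerivAt_const b z.2)
    have h2 : (fun y ↦ H y a b) =ᶠ[𝓝 z.2] fun y ↦ H y b a := hi.mono fun y hy ↦ hy.symm a b
    exact congrArg (fun l ↦ l c) ((h1 a b).unique ((h1 b a).congr_of_eventuallyEq h2))
  -- the mixed terms `f' / f` cancel by the symmetry of the Christoffel symbols of `H`
  have hΓs : christoffel H z.2 Y.2 X.2 = christoffel H z.2 X.2 Y.2 := by
    refine hiz.eq_of_forall fun w ↦ ?_
    rw [apply_christoffel hiz, apply_christoffel hiz, koszul_apply, koszul_apply,
      hsm w Y.2 X.2]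
    ring
  simp only [curvatureEndo, sub_apply, add_apply, ContinuousLinearMap.comp_apply, hder, h0]
  ext
  · simp only [Prod.fst_sub, Prod.fst_add, map_add, map_smul, smul_eq_mul]
    rw [hiz.symm X.2 (christoffel H z.2 Y.2 Z.2), hiz.symm Y.2 (christoffel H z.2 X.2 Z.2),
      apply_christoffel hiz, apply_christoffel hiz, koszul_apply, koszul_apply,
      hiz.symm Y.2 X.2, hsm Z.2 Y.2 X.2, hsm Y.2 Z.2 X.2, hsm X.2 Z.2 Y.2]
    field_simp
    ring
  · simp only [Prod.snd_sub, Prod.snd_add, map_add, map_smul]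
    rw [hΓs]
    match_scalars <;> field_simp <;> ring

end WarpedCoordinates

/-! ### Bivectors over an inner product space -/

section BivectorForms

variable {E : Type*} [NormedAddCommGroup E] [NormedSpace ℝ E]
  {F : Type*} [NormedAddCommGroup F] [NormedSpace ℝ F]

theorem bivector_linearMap_ext {V : Type*} [AddCommGroup V] [Module ℝ V] {A B : ⋀[ℝ]^2 E →ₗ[ℝ] V}
    (h : ∀ u v, A (wedge u v) = B (wedge u v)) : A = B := by
  refine exteriorPower.linearMap_ext (AlternatingMap.ext fun m ↦ ?_)
  have hm : m = ![m 0, m 1] := by ext i; fin_cases i <;> rfl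
  rw [hm]
  exact h _ _

theorem bivector_bilin_ext {A B : ⋀[ℝ]^2 E →ₗ[ℝ] ⋀[ℝ]^2 F →ₗ[ℝ] ℝ}
    (h : ∀ u v w z, A (wedge u v) (wedge w z) = B (wedge u v) (wedge w z)) : A = B :=
  bivector_linearMap_ext fun u v ↦ bivector_linearMap_ext fun w z ↦ h u v w z

theorem map_wedge (L : E →ₗ[ℝ] F) (u v : E) :
    exteriorPower.map 2 L (wedge u v) = wedge (L u) (L v) := by
  simp only [wedge, exteriorPower.map_apply_ιMulti]
  congr 1
  ext i; fin_cases i <;> rfl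

theorem wedge_add_left (u u' v : E) : wedge (u + u') v = wedge u v + wedge u' v :=
  (exteriorPower.ιMulti ℝ 2 (M := E)).map_update_add ![0, v] 0 u u'

theorem wedge_smul_left (c : ℝ) (u v : E) : wedge (c • u) v = c • wedge u v :=
  (exteriorPower.ιMulti ℝ 2 (M := E)).map_update_smul ![0, v] 0 c u

theorem wedge_swap (u v : E) : wedge v u = -wedge u v := by
  have h := (exteriorPower.ιMulti ℝ 2 (M := E)).map_swap ![u, v] (i := 0) (j := 1) (by decide)
  rw [wedge, wedge, ← h]
  congr 1
  ext i; fin_cases i <;> simp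

theorem wedge_add_right (u v v' : E) : wedge u (v + v') = wedge u v + wedge u v' := by
  rw [wedge_swap, wedge_add_left, neg_add, ← wedge_swap, ← wedge_swap]

theorem wedge_smul_right (c : ℝ) (u v : E) : wedge u (c • v) = c • wedge u v := by
  rw [wedge_swap, wedge_smul_left, wedge_swap u v]
  module

/-- `(u, v) ↦ u ∧ v` as a bilinear map. -/
def wedgeBilin : E →ₗ[ℝ] E →ₗ[ℝ] ⋀[ℝ]^2 E :=
  LinearMap.mk₂ ℝ wedge wedge_add_left wedge_smul_left wedge_add_right wedge_smul_right

theorem wedgeBilin_apply (u v : E) : wedgeBilin u v = wedge u v := rfl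

theorem bivectorForm_comm {b : E →L[ℝ] E →L[ℝ] ℝ} (hb : IsInner b) (θ η : ⋀[ℝ]^2 E) :
    bivectorForm b θ η = bivectorForm b η θ := by
  have h : bivectorForm b = (bivectorForm b).flip := bivector_bilin_ext fun u v w z ↦ by
    rw [LinearMap.flip_apply, bivectorForm_wedge, bivectorForm_wedge, hb.symm w u, hb.symm z v,
      hb.symm w v, hb.symm z u]
    ring
  exact congrArg (fun B ↦ B θ η) h

theorem IsInner.exists_orthogonal_basis [FiniteDimensional ℝ E] {b : E →L[ℝ] E →L[ℝ] ℝ}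
    (hb : IsInner b) : ∃ e : Module.Basis (Fin (Module.finrank ℝ E)) ℝ E,
      ∀ i j, i ≠ j → b (e i) (e j) = 0 := by
  obtain ⟨e, he⟩ := LinearMap.BilinForm.exists_orthogonal_basis
    (B := (ContinuousLinearMap.coeLM ℝ).comp b.toLinearMap) ⟨fun u v ↦ hb.symm u v⟩
  exact ⟨e, fun i j hij ↦ he hij⟩

/-- The expansion of a bivector in an orthogonal basis. -/
theorem bivector_expansion {ι : Type*} [Fintype ι] {b : E →L[ℝ] E →L[ℝ] ℝ}
    (hb : IsInner b) (e : Module.Basis ι ℝ E) (he : ∀ i j, i ≠ j → b (e i) (e j) = 0)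
    (θ : ⋀[ℝ]^2 E) :
    θ = ∑ i, ∑ j, (1 / 2 * (b (e i) (e i))⁻¹ * (b (e j) (e j))⁻¹ *
      bivectorForm b θ (wedge (e i) (e j))) • wedge (e i) (e j) := by
  have hd (i) : b (e i) (e i) ≠ 0 := (hb.pos _ (e.ne_zero i)).ne'
  have hv (v : E) : v = ∑ i, ((b (e i) (e i))⁻¹ * b v (e i)) • e i := by
    have hr (i) : (b (e i) (e i))⁻¹ * b v (e i) = e.repr v i := by
      conv_lhs => rw [← e.sum_repr v]
      simp only [map_sum, map_smul, sum_apply, smul_apply, smul_eq_mul]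
      rw [Finset.sum_eq_single i (fun j _ hj ↦ by rw [he j i hj, mul_zero]) (by simp)]
      field_simp [hd i]
    simp only [hr, e.sum_repr]
  let T : ⋀[ℝ]^2 E →ₗ[ℝ] ⋀[ℝ]^2 E := ∑ i, ∑ j, LinearMap.smulRight
    ((1 / 2 * (b (e i) (e i))⁻¹ * (b (e j) (e j))⁻¹) •
      (bivectorForm b).flip (wedge (e i) (e j))) (wedge (e i) (e j))
  have hT : LinearMap.id = T := by
    refine bivector_linearMap_ext fun u v ↦ ?_
    have h1 : wedge u v = ∑ i, ∑ j, (((b (e i) (e i))⁻¹ * b u (e i)) *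
        ((b (e j) (e j))⁻¹ * b v (e j))) • wedge (e i) (e j) := by
      conv_lhs => rw [hv u, hv v]
      simp only [← wedgeBilin_apply, map_sum, map_smul, LinearMap.sum_apply, LinearMap.smul_apply,
        Finset.smul_sum, smul_smul]
      rw [Finset.sum_comm]
      simp only [mul_comm]
    -- averaging the two expansions makes the coefficients equal to `⟨u ∧ v, eᵢ ∧ eⱼ⟩`
    have h2 : wedge u v = ∑ i, ∑ j, -((((b (e i) (e i))⁻¹ * b v (e i)) *
        ((b (e j) (e j))⁻¹ * b u (e j))) • wedge (e i) (e j)) := by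
      conv_lhs => rw [h1, Finset.sum_comm]
      refine Finset.sum_congr rfl fun i _ ↦ Finset.sum_congr rfl fun j _ ↦ ?_
      rw [wedge_swap, smul_neg, mul_comm]
    have h3 : wedge u v = (1 / 2 : ℝ) • (wedge u v + wedge u v) := by
      rw [← two_smul ℝ (wedge u v), smul_smul]; norm_num
    simp only [LinearMap.id_apply]
    rw [h3]
    conv_lhs => enter [2, 1]; rw [h1]
    conv_lhs => enter [2, 2]; rw [h2]
    rw [← h3]
    simp only [T, LinearMap.sum_apply, LinearMap.smulRight_apply, LinearMap.smul_apply,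
      LinearMap.flip_apply, bivectorForm_wedge, ← Finset.sum_add_distrib, Finset.smul_sum]
    refine Finset.sum_congr rfl fun i _ ↦ Finset.sum_congr rfl fun j _ ↦ ?_
    rw [smul_eq_mul]
    module
  have := congrArg (fun L ↦ L θ) hT
  simpa [T, LinearMap.sum_apply, mul_assoc] using this

theorem bivectorForm_self_eq_sum {ι : Type*} [Fintype ι] {b : E →L[ℝ] E →L[ℝ] ℝ}
    (hb : IsInner b) (e : Module.Basis ι ℝ E) (he : ∀ i j, i ≠ j → b (e i) (e j) = 0)
    (θ : ⋀[ℝ]^2 E) :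
    bivectorForm b θ θ = ∑ i, ∑ j, 1 / 2 * (b (e i) (e i))⁻¹ * (b (e j) (e j))⁻¹ *
      bivectorForm b θ (wedge (e i) (e j)) ^ 2 := by
  conv_lhs => enter [2]; rw [bivector_expansion hb e he θ]
  simp only [map_sum, map_smul, smul_eq_mul, sq, mul_assoc]

theorem bivectorForm_nonneg [FiniteDimensional ℝ E] {b : E →L[ℝ] E →L[ℝ] ℝ} (hb : IsInner b)
    (θ : ⋀[ℝ]^2 E) : 0 ≤ bivectorForm b θ θ := by
  obtain ⟨e, he⟩ := hb.exists_orthogonal_basis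
  rw [bivectorForm_self_eq_sum hb e he]
  have hd (i) : 0 < (b (e i) (e i))⁻¹ := inv_pos.2 (hb.pos _ (e.ne_zero i))
  exact Finset.sum_nonneg fun i _ ↦ Finset.sum_nonneg fun j _ ↦
    mul_nonneg (mul_nonneg (mul_nonneg (by norm_num) (hd i).le) (hd j).le) (sq_nonneg _)

theorem bivectorForm_pos [FiniteDimensional ℝ E] {b : E →L[ℝ] E →L[ℝ] ℝ} (hb : IsInner b)
    {θ : ⋀[ℝ]^2 E} (hθ : θ ≠ 0) : 0 < bivectorForm b θ θ := by
  refine (bivectorForm_nonneg hb θ).lt_of_ne fun h0 ↦ hθ ?_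
  obtain ⟨e, he⟩ := hb.exists_orthogonal_basis
  have hd (i) : 0 < (b (e i) (e i))⁻¹ := inv_pos.2 (hb.pos _ (e.ne_zero i))
  have hn (i j) : 0 ≤ 1 / 2 * (b (e i) (e i))⁻¹ * (b (e j) (e j))⁻¹ *
      bivectorForm b θ (wedge (e i) (e j)) ^ 2 :=
    mul_nonneg (mul_nonneg (mul_nonneg (by norm_num) (hd i).le) (hd j).le) (sq_nonneg _)
  rw [bivectorForm_self_eq_sum hb e he, eq_comm,
    Finset.sum_eq_zero_iff_of_nonneg fun i _ ↦ Finset.sum_nonneg fun j _ ↦ hn i j] at h0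
  rw [bivector_expansion hb e he θ]
  refine Finset.sum_eq_zero fun i _ ↦ Finset.sum_eq_zero fun j _ ↦ ?_
  have h1 := (Finset.sum_eq_zero_iff_of_nonneg fun j _ ↦ hn i j).1 (h0 i (Finset.mem_univ i)) j
    (Finset.mem_univ j)
  have h2 : bivectorForm b θ (wedge (e i) (e j)) = 0 := by
    have := (hd i).ne'
    have := (hd j).ne'
    simpa [*] using h1
  rw [h2, mul_zero, zero_smul]

/-- Let `A y`, `B y` be bilinear forms on a finite-dimensional space that depend continuously on
`y`, with `B y₀` symmetric and positive definite. Then the quadratic form of `A` is bounded below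
by a fixed multiple of that of `B`, near `y₀`. -/
theorem eventually_quadratic_lower_bound {V Y : Type*} [AddCommGroup V] [Module ℝ V]
    [FiniteDimensional ℝ V] [TopologicalSpace Y] {A B : Y → V →ₗ[ℝ] V →ₗ[ℝ] ℝ} {y₀ : Y}
    (hA : ∀ v w, ContinuousAt (fun y ↦ A y v w) y₀) (hB : ∀ v w, ContinuousAt (fun y ↦ B y v w) y₀)
    (hsymm : ∀ v w, B y₀ v w = B y₀ w v) (hpos : ∀ v, v ≠ 0 → 0 < B y₀ v v) :
    ∃ C : ℝ, ∀ᶠ y in 𝓝 y₀, ∀ v, -C * B y v v ≤ A y v v := by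
  obtain ⟨e, he⟩ := LinearMap.BilinForm.exists_orthogonal_basis (B := B y₀) ⟨fun u v ↦ hsymm u v⟩
  -- the squared Euclidean norm in the basis `e`, and the quadratic forms in this basis
  let N : V → ℝ := fun v ↦ ∑ i, e.repr v i ^ 2
  have hN (v) : 0 ≤ N v := Finset.sum_nonneg fun i _ ↦ sq_nonneg _
  have hexp (D : V →ₗ[ℝ] V →ₗ[ℝ] ℝ) (v : V) :
      D v v = ∑ i, ∑ j, e.repr v i * (e.repr v j * D (e i) (e j)) := by
    conv_lhs => rw [← e.sum_repr v]
    simp only [map_sum, map_smul, LinearMap.sum_apply, LinearMap.smul_apply, smul_eq_mul,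
      Finset.mul_sum]
    rw [Finset.sum_comm]
    refine Finset.sum_congr rfl fun i _ ↦ Finset.sum_congr rfl fun j _ ↦ by ring
  have hbound (D : V →ₗ[ℝ] V →ₗ[ℝ] ℝ) (v : V) :
      -((∑ i, ∑ j, |D (e i) (e j)|) * N v) ≤ D v v := by
    rw [hexp, Finset.sum_mul, ← Finset.sum_neg_distrib]
    refine Finset.sum_le_sum fun i _ ↦ ?_
    rw [Finset.sum_mul, ← Finset.sum_neg_distrib]
    refine Finset.sum_le_sum fun j _ ↦ ?_
    have hi : e.repr v i ^ 2 ≤ N v :=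
      Finset.single_le_sum (f := fun i ↦ e.repr v i ^ 2) (fun _ _ ↦ sq_nonneg _) (Finset.mem_univ i)
    have hj : e.repr v j ^ 2 ≤ N v :=
      Finset.single_le_sum (f := fun i ↦ e.repr v i ^ 2) (fun _ _ ↦ sq_nonneg _) (Finset.mem_univ j)
    have h1 : |e.repr v i * e.repr v j| ≤ N v := by
      rw [abs_le]
      constructor <;> nlinarith [sq_nonneg (e.repr v i + e.repr v j),
        sq_nonneg (e.repr v i - e.repr v j)]
    have h2 := mul_le_mul_of_nonneg_left h1 (abs_nonneg (D (e i) (e j)))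
    rw [← abs_mul] at h2
    have h3 := (abs_le.1 h2).1
    linarith
  obtain ⟨δ, hδ, hδB⟩ : ∃ δ > 0, ∀ v, δ * N v ≤ B y₀ v v := by
    have hex : ∃ δ > 0, ∀ i, δ ≤ B y₀ (e i) (e i) := by
      have hd (i) : 0 < B y₀ (e i) (e i) := hpos _ (e.ne_zero i)
      rcases isEmpty_or_nonempty (Fin (Module.finrank ℝ V)) with h | h
      · exact ⟨1, one_pos, fun i ↦ h.elim i⟩
      · obtain ⟨i, hi⟩ := Finite.exists_min fun i ↦ B y₀ (e i) (e i)
        exact ⟨_, hd i, hi⟩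
    obtain ⟨δ, hδ, h⟩ := hex
    refine ⟨δ, hδ, fun v ↦ ?_⟩
    rw [hexp, Finset.mul_sum]
    refine Finset.sum_le_sum fun i _ ↦ ?_
    rw [Finset.sum_eq_single i (fun j _ hj ↦ by
      rw [show B y₀ (e i) (e j) = 0 from he hj.symm]; ring) (by simp)]
    nlinarith [h i, sq_nonneg (e.repr v i)]
  let α : ℝ := ∑ i, ∑ j, |A y₀ (e i) (e j)|
  -- `A + C B` is at least `N` at `y₀`, hence nonnegative nearby
  let C : ℝ := (α + 1) / δ
  have hα : 0 ≤ α := Finset.sum_nonneg fun i _ ↦ Finset.sum_nonneg fun j _ ↦ abs_nonneg _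
  have h0 (v) : N v ≤ A y₀ v v + C * B y₀ v v := by
    have h1 := hbound (A y₀) v
    have h2 : (α + 1) * N v ≤ C * B y₀ v v := by
      have := mul_le_mul_of_nonneg_left (hδB v) (by positivity : 0 ≤ C)
      rwa [← mul_assoc, div_mul_cancel₀ _ hδ.ne'] at this
    change -(α * N v) ≤ _ at h1
    linarith
  refine ⟨C, ?_⟩
  have hcont : ContinuousAt (fun y ↦ ∑ i, ∑ j,
      |((A y + C • B y) - (A y₀ + C • B y₀)) (e i) (e j)|) y₀ := by
    refine tendsto_finsetSum _ fun i _ ↦ tendsto_finsetSum _ fun j _ ↦ ?_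
    simp only [LinearMap.sub_apply, LinearMap.add_apply, LinearMap.smul_apply, smul_eq_mul]
    exact (((hA _ _).add (continuousAt_const.mul (hB _ _))).sub continuousAt_const).abs
  have hev := hcont.eventually_lt (continuousAt_const (y := (1 : ℝ))) (by simp)
  filter_upwards [hev] with y hy v
  have h1 := hbound ((A y + C • B y) - (A y₀ + C • B y₀)) v
  have h2 := mul_le_mul_of_nonneg_right hy.le (hN v)
  simp only [LinearMap.sub_apply, LinearMap.add_apply, LinearMap.smul_apply, smul_eq_mul] at h1 h2
  linarith [h0 v]

end BivectorForms

/-! ### Parametrizations of a Riemannian manifold -/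

section Parametrizations

set_option maxSynthPendingDepth 3

variable {E : Type*} [NormedAddCommGroup E] [NormedSpace ℝ E]
  {H : Type*} [TopologicalSpace H] {I : ModelWithCorners ℝ E H}
  {M : Type*} [TopologicalSpace M] [ChartedSpace H M]
  {F : Type*} [NormedAddCommGroup F] [NormedSpace ℝ F]
  {F' : Type*} [NormedAddCommGroup F'] [NormedSpace ℝ F']

variable (I) in
/-- The derivative of a map from a vector space into a manifold, as a map of vector spaces. -/
def paramDeriv (ψ : F → M) (y : F) : F →L[ℝ] E := mfderiv 𝓘(ℝ, F) I ψ y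

theorem paramDeriv_comp {ψ : F → M} {φ : F' → F} {z : F'}
    (hψ : MDifferentiableAt 𝓘(ℝ, F) I ψ (φ z)) (hφ : DifferentiableAt ℝ φ z) :
    paramDeriv I (ψ ∘ φ) z = (paramDeriv I ψ (φ z)).comp (fderiv ℝ φ z) := by
  unfold paramDeriv
  rw [mfderiv_comp z hψ hφ.mdifferentiableAt, mfderiv_eq_fderiv]
  rfl

theorem paramDeriv_congr {ψ ψ' : F → M} {y : F} (h : ψ =ᶠ[𝓝 y] ψ') :
    paramDeriv I ψ y = paramDeriv I ψ' y :=
  h.mfderiv_eq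

theorem paramDeriv_extChartAt_symm_self [IsManifold I 1 M] [I.Boundaryless] (x : M) :
    paramDeriv I (extChartAt I x).symm (extChartAt I x x) = ContinuousLinearMap.id ℝ E := by
  have := mfderivWithin_range_extChartAt_symm (I := I) (x := x)
  rw [I.range_eq_univ, mfderivWithin_univ] at this
  exact this

theorem isInvertible_paramDeriv_extChartAt_symm [IsManifold I 1 M] [I.Boundaryless] {x : M} {y : E}
    (hy : y ∈ (extChartAt I x).target) :
    (paramDeriv I (extChartAt I x).symm y).IsInvertible := by
  have := isInvertible_mfderivWithin_extChartAt_symm hy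
  rw [I.range_eq_univ, mfderivWithin_univ] at this
  exact this

variable [IsManifold I ∞ M]

/-- The pull-back of a Riemannian metric by a map from a vector space to the manifold. For the
inverse of the preferred chart at `x` this is `metricInChart g x`, by definition. -/
def pullbackMetric (g : RMetric I M) (ψ : F → M) (y : F) : F →L[ℝ] F →L[ℝ] ℝ :=
  (metricAt g (ψ y)).bilinearComp (paramDeriv I ψ y) (paramDeriv I ψ y)

theorem isInner_metricAt (g : RMetric I M) (x : M) : IsInner (metricAt g x) :=
  ⟨g.symm x, g.pos x⟩

theorem isInner_pullbackMetric (g : RMetric I M) {ψ : F → M} {y : F}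
    (h : Function.Injective (paramDeriv I ψ y)) : IsInner (pullbackMetric g ψ y) :=
  (isInner_metricAt g (ψ y)).bilinearComp h

theorem pullbackMetric_congr (g : RMetric I M) {ψ ψ' : F → M} {y : F} (h : ψ =ᶠ[𝓝 y] ψ') :
    pullbackMetric g ψ =ᶠ[𝓝 y] pullbackMetric g ψ' := by
  filter_upwards [h.eventually_nhds] with z hz
  rw [pullbackMetric, pullbackMetric, hz.self_of_nhds, paramDeriv_congr hz]

theorem pullbackMetric_comp (g : RMetric I M) {ψ : F → M} {φ : F' → F} {z : F'}
    (hψ : MDifferentiableAt 𝓘(ℝ, F) I ψ (φ z)) (hφ : DifferentiableAt ℝ φ z) :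
    pullbackMetric g (ψ ∘ φ) z =
      (pullbackMetric g ψ (φ z)).bilinearComp (fderiv ℝ φ z) (fderiv ℝ φ z) := by
  rw [pullbackMetric, paramDeriv_comp hψ hφ]
  rfl

theorem contDiffOn_pullbackMetric [FiniteDimensional ℝ F] (g : RMetric I M) {ψ : F → M} {s : Set F}
    (hs : IsOpen s) (hψ : ContMDiffOn 𝓘(ℝ, F) I ∞ ψ s) : ContDiffOn ℝ ∞ (pullbackMetric g ψ) s := by
  rw [contDiffOn_clm_apply]
  intro v
  rw [contDiffOn_clm_apply]
  intro w
  -- the fields `y ↦ dψ_y v` along `ψ` are smooth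
  have hsec (v : F) : ContMDiffOn 𝓘(ℝ, F) (I.prod 𝓘(ℝ, E)) ∞
      (fun y ↦ (⟨ψ y, mfderiv 𝓘(ℝ, F) I ψ y v⟩ : TangentBundle I M)) s := by
    have h1 : ContMDiffOn 𝓘(ℝ, F).tangent I.tangent ∞ (tangentMapWithin 𝓘(ℝ, F) I ψ s) _ :=
      hψ.contMDiffOn_tangentMapWithin (m := ∞) le_rfl hs.uniqueMDiffOn
    have h2 : ContMDiffOn 𝓘(ℝ, F) 𝓘(ℝ, F).tangent ∞
        (fun y ↦ (⟨y, v⟩ : TangentBundle 𝓘(ℝ, F) F)) s :=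
      contMDiffOn_vectorSpace_iff_contDiffOn.2 contDiffOn_const
    refine (h1.comp h2 fun y hy ↦ hy).congr fun y hy ↦ ?_
    simp only [Function.comp_apply, tangentMapWithin, mfderivWithin_of_isOpen hs hy]
  intro y hy
  have hg : ContMDiffAt 𝓘(ℝ, F) (I.prod 𝓘(ℝ, E →L[ℝ] E →L[ℝ] ℝ)) ∞
      (fun y ↦ Bundle.TotalSpace.mk' (E →L[ℝ] E →L[ℝ] ℝ)
        (E := fun x : M ↦ (TangentSpace I x →L[ℝ] TangentSpace I x →L[ℝ] ℝ)) (ψ y)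
        (g.inner (ψ y))) y :=
    (g.contMDiff (ψ y)).comp y (hψ.contMDiffAt (hs.mem_nhds hy))
  have h3 := ContMDiffAt.clm_bundle_apply₂ (F₃ := ℝ) (E₃ := Bundle.Trivial M ℝ) hg
    ((hsec v).contMDiffAt (hs.mem_nhds hy)) ((hsec w).contMDiffAt (hs.mem_nhds hy))
  rw [Bundle.contMDiffAt_totalSpace] at h3
  exact (contMDiffAt_iff_contDiffAt.1 h3.2).contDiffWithinAt

/-- The curvature can be computed in any parametrization `ψ`, not just in the preferred chart. -/
theorem curvature_paramDeriv [I.Boundaryless] [FiniteDimensional ℝ E] [FiniteDimensional ℝ F]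
    (g : RMetric I M) {ψ : F → M} {s : Set F} (hs : IsOpen s) (hψ : ContMDiffOn 𝓘(ℝ, F) I ∞ ψ s)
    {y : F} (hy : y ∈ s) (hinv : (paramDeriv I ψ y).IsInvertible) (u v w : F) :
    curvature g (ψ y) (paramDeriv I ψ y u) (paramDeriv I ψ y v) (paramDeriv I ψ y w) =
      paramDeriv I ψ y (curvatureEndo (pullbackMetric g ψ) y u v w) := by
  have : IsManifold I 1 M := .of_le (n := ∞) (by norm_num)
  set x := ψ y with hx
  let σ : E → M := (extChartAt I x).symm
  let φ : F → E := extChartAt I x ∘ ψ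
  have hψy : ContMDiffAt 𝓘(ℝ, F) I ∞ ψ y := hψ.contMDiffAt (hs.mem_nhds hy)
  have hφ : ContDiffAt ℝ ∞ φ y := by
    rw [← contMDiffAt_iff_contDiffAt]
    exact contMDiffAt_extChartAt.comp y hψy
  have hφy : φ y = extChartAt I x x := rfl
  have htarget : (extChartAt I x).target ∈ 𝓝 (φ y) := extChartAt_target_mem_nhds x
  have hσφ : ψ =ᶠ[𝓝 y] σ ∘ φ := by
    have h1 : ∀ᶠ z in 𝓝 y, ψ z ∈ (extChartAt I x).source :=
      hψy.continuousAt.eventually (extChartAt_source_mem_nhds x)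
    filter_upwards [h1] with z hz
    exact ((extChartAt I x).left_inv hz).symm
  have hσ : ContMDiffOn 𝓘(ℝ, E) I ∞ σ (extChartAt I x).target := contMDiffOn_extChartAt_symm x
  have hopen : IsOpen (extChartAt I x).target := isOpen_extChartAt_target x
  have hσd : ∀ z ∈ (extChartAt I x).target, MDifferentiableAt 𝓘(ℝ, E) I σ z := fun z hz ↦
    (hσ.contMDiffAt (hopen.mem_nhds hz)).mdifferentiableAt (by simp)
  -- the preferred chart at `x` induces the identity on `T_x M`
  have hd : paramDeriv I ψ y = fderiv ℝ φ y := by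
    rw [paramDeriv_congr hσφ, paramDeriv_comp (φ := φ) (hσd _ (mem_extChartAt_target x))
      (hφ.differentiableAt (by simp)), hφy, paramDeriv_extChartAt_symm_self]
    rfl
  have hG' : pullbackMetric g ψ =ᶠ[𝓝 y] fun z ↦
      (metricInChart g x (φ z)).bilinearComp (fderiv ℝ φ z) (fderiv ℝ φ z) := by
    have h1 : ∀ᶠ z in 𝓝 y, DifferentiableAt ℝ φ z :=
      ((hφ.of_le (m := 1) (by simp)).eventually (by simp)).mono fun z hz ↦
        hz.differentiableAt one_ne_zero
    filter_upwards [pullbackMetric_congr g hσφ, h1, hφ.continuousAt.eventually htarget]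
      with z hz1 hz2 hz3
    rw [hz1, pullbackMetric_comp g (hσd _ hz3) hz2]
    rfl
  have hG : ContDiffAt ℝ ∞ (metricInChart g x) (φ y) :=
    (contDiffOn_pullbackMetric g hopen hσ).contDiffAt htarget
  have hi : ∀ᶠ z in 𝓝 (φ y), IsInner (metricInChart g x z) := by
    filter_upwards [htarget] with z hz
    exact isInner_pullbackMetric g (isInvertible_paramDeriv_extChartAt_symm hz).injective
  rw [hd] at hinv ⊢
  exact (curvatureEndo_pullback (hφ.of_le ENat.LEInfty.out) hinv (hG.of_le ENat.LEInfty.out) hi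
    hG' u v w).symm

end Parametrizations

/-! ### The curvature operator in coordinates -/

section CurvatureForms

set_option maxSynthPendingDepth 3

variable {E : Type*} [NormedAddCommGroup E] [NormedSpace ℝ E]

/-- The contraction of a bivector on `ℝ × E` with `dr`: `(a, v) ∧ (b, w) ↦ a w - b v`. -/
def radialContraction : ⋀[ℝ]^2 (ℝ × E) →ₗ[ℝ] E :=
  exteriorPower.alternatingMapLinearEquiv
    { toFun := fun m ↦ (m 0).1 • (m 1).2 - (m 1).1 • (m 0).2
      map_update_add' := fun m i a b ↦ by fin_cases i <;> simp [add_smul] <;> abel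
      map_update_smul' := fun m i c a ↦ by
        fin_cases i <;> simp [smul_sub, smul_smul, mul_comm]
      map_eq_zero_of_eq' := fun m i j hij hne ↦ by
        have h01 : m 0 = m 1 := by
          fin_cases i <;> fin_cases j <;> simp_all
        simp [h01] }

theorem radialContraction_wedge (X Y : ℝ × E) :
    radialContraction (wedge X Y) = X.1 • Y.2 - Y.1 • X.2 := by
  simp only [radialContraction, wedge, exteriorPower.alternatingMapLinearEquiv_apply_ιMulti]
  rfl

/-- The tangential part of a bivector on `ℝ × E`. -/
def tangentialPart : ⋀[ℝ]^2 (ℝ × E) →ₗ[ℝ] ⋀[ℝ]^2 E :=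
  exteriorPower.map 2 (LinearMap.snd ℝ ℝ E)

theorem tangentialPart_wedge (X Y : ℝ × E) : tangentialPart (wedge X Y) = wedge X.2 Y.2 :=
  map_wedge _ X Y

theorem bivectorForm_warpedMetric (f : ℝ → ℝ) (H : E → E →L[ℝ] E →L[ℝ] ℝ) (z : ℝ × E)
    (θ η : ⋀[ℝ]^2 (ℝ × E)) :
    bivectorForm (warpedMetric f H z) θ η =
      f z.1 ^ 2 * H z.2 (radialContraction θ) (radialContraction η)
        + f z.1 ^ 4 * bivectorForm (H z.2) (tangentialPart θ) (tangentialPart η) := by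
  let B : ⋀[ℝ]^2 (ℝ × E) →ₗ[ℝ] ⋀[ℝ]^2 (ℝ × E) →ₗ[ℝ] ℝ :=
    f z.1 ^ 2 • ((ContinuousLinearMap.coeLM ℝ).comp (H z.2).toLinearMap).compl₁₂
        radialContraction radialContraction
      + f z.1 ^ 4 • (bivectorForm (H z.2)).compl₁₂ tangentialPart tangentialPart
  have hB : bivectorForm (warpedMetric f H z) = B := bivector_bilin_ext fun X Y W Z ↦ by
    simp only [B, LinearMap.add_apply, LinearMap.smul_apply, LinearMap.compl₁₂_apply,
      bivectorForm_wedge, radialContraction_wedge, tangentialPart_wedge, warpedMetric_apply,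
      LinearMap.comp_apply, smul_eq_mul]
    simp
    ring
  rw [hB]
  rfl

/-- There are no nonzero bivectors on a line. -/
theorem bivector_eq_zero_of_subsingleton [Subsingleton E] (θ : ⋀[ℝ]^2 (ℝ × E)) : θ = 0 := by
  have h : (LinearMap.id : ⋀[ℝ]^2 (ℝ × E) →ₗ[ℝ] ⋀[ℝ]^2 (ℝ × E)) = 0 :=
    bivector_linearMap_ext fun X Y ↦ by
      have hX (X : ℝ × E) : X = X.1 • ((1, 0) : ℝ × E) :=
        Prod.ext (by simp) (Subsingleton.elim _ _)
      have h0 : wedge ((1, 0) : ℝ × E) (1, 0) = 0 :=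
        AlternatingMap.map_eq_zero_of_eq _ _ (i := 0) (j := 1) rfl (by decide)
      rw [hX X, hX Y, wedge_smul_left, wedge_smul_right, h0]
      simp
  exact congrArg (fun L ↦ L θ) h

variable [FiniteDimensional ℝ E]


/-- The bilinear form `⟨R θ, η⟩` on bivectors, for the curvature operator `R` of the metric `G` in
coordinates. -/
def curvatureForm (G : E → E →L[ℝ] E →L[ℝ] ℝ) (y : E) : ⋀[ℝ]^2 E →ₗ[ℝ] ⋀[ℝ]^2 E →ₗ[ℝ] ℝ :=
  bivectorForm (G y) ∘ₗ exteriorPower.alternatingMapLinearEquiv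
    ((bivectorOfEndo (G y)).compAlternatingMap (curvatureAlt G y))

theorem curvatureForm_wedge {G : E → E →L[ℝ] E →L[ℝ] ℝ} {y : E} (hG : IsInner (G y))
    (u v w z : E) : curvatureForm G y (wedge u v) (wedge w z) =
      (1 / 2 : ℝ) * (G y (curvatureEndo G y u v z) w - G y (curvatureEndo G y u v w) z) := by
  have h : exteriorPower.alternatingMapLinearEquiv
      ((bivectorOfEndo (G y)).compAlternatingMap (curvatureAlt G y)) (wedge u v) =
      bivectorOfEndo (G y) (curvatureEndo G y u v) := by
    simp only [wedge, exteriorPower.alternatingMapLinearEquiv_apply_ιMulti]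
    rfl
  rw [curvatureForm, LinearMap.comp_apply, h]
  exact bivectorForm_bivectorOfEndo (G y) hG.pos _ w z

theorem curvatureForm_congr {G G' : E → E →L[ℝ] E →L[ℝ] ℝ} {y : E} (h : G =ᶠ[𝓝 y] G') :
    curvatureForm G y = curvatureForm G' y := by
  have hA : curvatureAlt G y = curvatureAlt G' y :=
    AlternatingMap.ext fun m ↦ congrFun (congrFun (curvatureEndo_congr h) (m 0)) (m 1)
  rw [curvatureForm, curvatureForm, hA, h.self_of_nhds]

/-- The curvature operator of `G` at the point `y` is bounded below by `κ • id`. -/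
def CurvatureGEAt (G : E → E →L[ℝ] E →L[ℝ] ℝ) (y : E) (κ : ℝ) : Prop :=
  ∀ θ : ⋀[ℝ]^2 E, κ * bivectorForm (G y) θ θ ≤ curvatureForm G y θ θ

theorem continuousAt_bilin_of_wedge {Y : Type*} [TopologicalSpace Y]
    {A : Y → ⋀[ℝ]^2 E →ₗ[ℝ] ⋀[ℝ]^2 E →ₗ[ℝ] ℝ} {y₀ : Y}
    (h : ∀ u v w z, ContinuousAt (fun y ↦ A y (wedge u v) (wedge w z)) y₀) (θ η : ⋀[ℝ]^2 E) :
    ContinuousAt (fun y ↦ A y θ η) y₀ := by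
  let e := (Module.finBasis ℝ E).exteriorPower 2
  have he (i) : ∃ u v, e i = wedge u v := by
    rw [exteriorPower.basis_apply]
    exact ⟨_, _, congrArg (exteriorPower.ιMulti ℝ 2)
      (List.ofFn_injective (by simp; exact ⟨rfl, rfl⟩))⟩
  have hexp (y) : A y θ η = ∑ i, ∑ j, e.repr θ i * (e.repr η j * A y (e i) (e j)) := by
    conv_lhs => rw [← e.sum_repr θ, ← e.sum_repr η]
    simp only [map_sum, map_smul, LinearMap.sum_apply, LinearMap.smul_apply, smul_eq_mul,
      Finset.mul_sum]
    rw [Finset.sum_comm]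
    refine Finset.sum_congr rfl fun i _ ↦ Finset.sum_congr rfl fun j _ ↦ by ring
  simp only [hexp]
  refine tendsto_finsetSum _ fun i _ ↦ tendsto_finsetSum _ fun j _ ↦ ?_
  obtain ⟨u, v, hi⟩ := he i
  obtain ⟨w, z, hj⟩ := he j
  rw [hi, hj]
  exact (h u v w z).const_mul _ |>.const_mul _

theorem continuousAt_curvatureEndo {G : E → E →L[ℝ] E →L[ℝ] ℝ} {y₀ : E}
    (hG : ContDiffAt ℝ 2 G y₀) (hi : IsInner (G y₀)) (u v w : E) :
    ContinuousAt (fun y ↦ curvatureEndo G y u v w) y₀ := by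
  have hΓ : ContDiffAt ℝ 1 (christoffel G) y₀ :=
    contDiffAt_christoffel (n := 1) (hG.of_le (by norm_num)) hi
  have h0 : ContinuousAt (christoffel G) y₀ := hΓ.continuousAt
  have h1 : ContinuousAt (fderiv ℝ (christoffel G)) y₀ :=
    (hΓ.fderiv_right (m := 0) (by norm_num)).continuousAt
  simp only [curvatureEndo, sub_apply, add_apply, ContinuousLinearMap.comp_apply]
  fun_prop

/-- A smooth metric has curvature operator locally bounded below. -/
theorem eventually_curvatureGEAt {G : E → E →L[ℝ] E →L[ℝ] ℝ} {y₀ : E}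
    (hG : ContDiffAt ℝ 2 G y₀) (hi : ∀ᶠ y in 𝓝 y₀, IsInner (G y)) :
    ∃ C : ℝ, ∀ᶠ y in 𝓝 y₀, CurvatureGEAt G y (-C) := by
  have hGc : ContinuousAt G y₀ := hG.continuousAt
  refine eventually_quadratic_lower_bound (A := curvatureForm G) (B := fun y ↦ bivectorForm (G y))
    (continuousAt_bilin_of_wedge fun u v w z ↦ ?_) (continuousAt_bilin_of_wedge fun u v w z ↦ ?_)
    (bivectorForm_comm hi.self_of_nhds) (fun θ hθ ↦ bivectorForm_pos hi.self_of_nhds hθ)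
  · have h1 := continuousAt_curvatureEndo hG hi.self_of_nhds u v z
    have h2 := continuousAt_curvatureEndo hG hi.self_of_nhds u v w
    have h3 : ContinuousAt (fun y ↦ (1 / 2 : ℝ) *
        (G y (curvatureEndo G y u v z) w - G y (curvatureEndo G y u v w) z)) y₀ := by
      fun_prop
    exact h3.congr (hi.mono fun y hy ↦ (curvatureForm_wedge hy u v w z).symm)
  · simp only [bivectorForm_wedge]
    fun_prop

/-- The curvature operator of a warped product respects the splitting of bivectors into their
radial and tangential parts. -/
theorem curvatureForm_warpedMetric {f : ℝ → ℝ} {H : E → E →L[ℝ] E →L[ℝ] ℝ} {z : ℝ × E}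
    (hf : ContDiffAt ℝ 2 f z.1) (hH : ContDiffAt ℝ 2 H z.2) (hpos : 0 < f z.1)
    (hi : ∀ᶠ y in 𝓝 z.2, IsInner (H y)) (θ η : ⋀[ℝ]^2 (ℝ × E)) :
    curvatureForm (warpedMetric f H) z θ η =
      -(f z.1 * deriv (deriv f) z.1) * H z.2 (radialContraction θ) (radialContraction η)
        + f z.1 ^ 2 * (curvatureForm H z.2 (tangentialPart θ) (tangentialPart η)
          - deriv f z.1 ^ 2 * bivectorForm (H z.2) (tangentialPart θ) (tangentialPart η)) := by
  have hiz := hi.self_of_nhds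
  let B : ⋀[ℝ]^2 (ℝ × E) →ₗ[ℝ] ⋀[ℝ]^2 (ℝ × E) →ₗ[ℝ] ℝ :=
    (-(f z.1 * deriv (deriv f) z.1)) • ((ContinuousLinearMap.coeLM ℝ).comp
        (H z.2).toLinearMap).compl₁₂ radialContraction radialContraction
      + f z.1 ^ 2 • ((curvatureForm H z.2).compl₁₂ tangentialPart tangentialPart
        - deriv f z.1 ^ 2 • (bivectorForm (H z.2)).compl₁₂ tangentialPart tangentialPart)
  have hB : curvatureForm (warpedMetric f H) z = B := bivector_bilin_ext fun X Y W Z ↦ by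
    rw [curvatureForm_wedge (isInner_warpedMetric hpos hiz), curvatureEndo_warpedMetric hf hH hpos hi,
      curvatureEndo_warpedMetric hf hH hpos hi]
    simp only [B, LinearMap.add_apply, LinearMap.sub_apply, LinearMap.smul_apply,
      LinearMap.compl₁₂_apply, bivectorForm_wedge, radialContraction_wedge, tangentialPart_wedge,
      warpedMetric_apply, LinearMap.comp_apply, smul_eq_mul, curvatureForm_wedge hiz]
    simp
    field_simp
    ring
  rw [hB]
  rfl

/-- The trace of `w ↦ R(w, ∂r) ∂r` for a warped product, i.e. its radial Ricci curvature. -/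
theorem trace_curvatureEndo_warpedMetric {f : ℝ → ℝ} {H : E → E →L[ℝ] E →L[ℝ] ℝ} {z : ℝ × E}
    (hf : ContDiffAt ℝ 2 f z.1) (hH : ContDiffAt ℝ 2 H z.2) (hpos : 0 < f z.1)
    (hi : ∀ᶠ y in 𝓝 z.2, IsInner (H y)) (T : (ℝ × E) →ₗ[ℝ] (ℝ × E))
    (hT : ∀ X, T X = curvatureEndo (warpedMetric f H) z X (1, 0) (1, 0)) :
    LinearMap.trace ℝ (ℝ × E) T = -(Module.finrank ℝ E * (deriv (deriv f) z.1 / f z.1)) := by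
  have h : T = LinearMap.prodMap 0 (-(deriv (deriv f) z.1 / f z.1) • LinearMap.id) := by
    ext X <;> simp [hT, curvatureEndo_warpedMetric hf hH hpos hi]
  rw [h, LinearMap.trace_prodMap']
  simp
  ring

/-- The curvature operator of a warped product is bounded below if `f'' / f` is bounded above and
the curvature operator of the fibre is at least `f'^2 - C f^2`. -/
theorem curvatureGEAt_warpedMetric {f : ℝ → ℝ} {H : E → E →L[ℝ] E →L[ℝ] ℝ} {z : ℝ × E} {C : ℝ}
    (hf : ContDiffAt ℝ 2 f z.1) (hH : ContDiffAt ℝ 2 H z.2) (hpos : 0 < f z.1)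
    (hi : ∀ᶠ y in 𝓝 z.2, IsInner (H y)) (hf'' : deriv (deriv f) z.1 ≤ C * f z.1)
    (hfib : CurvatureGEAt H z.2 (deriv f z.1 ^ 2 - C * f z.1 ^ 2)) :
    CurvatureGEAt (warpedMetric f H) z (-C) := by
  intro θ
  rw [curvatureForm_warpedMetric hf hH hpos hi, bivectorForm_warpedMetric]
  have h1 := hi.self_of_nhds.nonneg (radialContraction θ)
  have h2 := hfib (tangentialPart θ)
  have h3 := mul_le_mul_of_nonneg_left hf'' (mul_nonneg hpos.le h1)
  have h4 := mul_le_mul_of_nonneg_left h2 (sq_nonneg (f z.1))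
  nlinarith

/-- Conversely, the curvature of the fibre is bounded below by that of the warped product. -/
theorem CurvatureGEAt.fibre {f : ℝ → ℝ} {H : E → E →L[ℝ] E →L[ℝ] ℝ} {z : ℝ × E} {C : ℝ}
    (hf : ContDiffAt ℝ 2 f z.1) (hH : ContDiffAt ℝ 2 H z.2) (hpos : 0 < f z.1)
    (hi : ∀ᶠ y in 𝓝 z.2, IsInner (H y)) (h : CurvatureGEAt (warpedMetric f H) z (-C)) :
    CurvatureGEAt H z.2 (deriv f z.1 ^ 2 - C * f z.1 ^ 2) := by
  intro η
  let θ := exteriorPower.map 2 (LinearMap.inr ℝ ℝ E) η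
  have h1 : radialContraction θ = 0 := by
    have : radialContraction ∘ₗ exteriorPower.map 2 (LinearMap.inr ℝ ℝ E) = 0 :=
      bivector_linearMap_ext fun u v ↦ by
        simp [map_wedge, radialContraction_wedge]
    exact congrArg (fun L ↦ L η) this
  have h2 : tangentialPart θ = η := by
    have : tangentialPart ∘ₗ exteriorPower.map 2 (LinearMap.inr ℝ ℝ E) = LinearMap.id :=
      bivector_linearMap_ext fun u v ↦ by
        simp [map_wedge, tangentialPart_wedge]
    exact congrArg (fun L ↦ L η) this
  have h3 := h θ
  rw [curvatureForm_warpedMetric hf hH hpos hi, bivectorForm_warpedMetric, h1, h2] at h3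
  simp only [map_zero, mul_zero, zero_add] at h3
  have h4 : 0 < f z.1 ^ 2 := pow_pos hpos 2
  refine le_of_mul_le_mul_left ?_ h4
  linarith

end CurvatureForms

/-! ### Differential inequalities for the warping function -/

section WarpingFunction

variable {f : ℝ → ℝ} {k : ℝ}

/-- If `f'' ≤ k² f`, then `(e^{kr} (f' - k f))' = e^{kr} (f'' - k² f) ≤ 0`. -/
theorem antitoneOn_exp_mul_deriv_sub {J : Set ℝ} (hJ : Convex ℝ J)
    (hf : ∀ r ∈ J, ContDiffAt ℝ 2 f r) (hf'' : ∀ r ∈ J, deriv (deriv f) r ≤ k ^ 2 * f r) :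
    AntitoneOn (fun r ↦ Real.exp (k * r) * (deriv f r - k * f r)) J := by
  have hd : ∀ r ∈ J, HasDerivAt (fun r ↦ Real.exp (k * r) * (deriv f r - k * f r))
      (Real.exp (k * r) * (deriv (deriv f) r - k ^ 2 * f r)) r := by
    intro r hr
    have h1 : HasDerivAt f (deriv f r) r := ((hf r hr).differentiableAt two_ne_zero).hasDerivAt
    have h2 : HasDerivAt (deriv f) (deriv (deriv f) r) r :=
      (differentiableAt_deriv (hf r hr)).hasDerivAt
    have h3 : HasDerivAt (fun r ↦ Real.exp (k * r)) (Real.exp (k * r) * k) r := by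
      simpa using ((hasDerivAt_id r).const_mul k).exp
    refine (h3.mul (h2.sub (h1.const_mul k))).congr_deriv ?_
    simp only [Pi.sub_apply]
    ring
  refine antitoneOn_of_deriv_nonpos hJ (fun r hr ↦ (hd r hr).continuousAt.continuousWithinAt)
    (fun r hr ↦ (hd r (interior_subset hr)).differentiableAt.differentiableWithinAt) fun r hr ↦ ?_
  rw [(hd r (interior_subset hr)).deriv]
  exact mul_nonpos_of_nonneg_of_nonpos (Real.exp_pos _).le
    (sub_nonpos.2 (hf'' r (interior_subset hr)))

/-- A positive function with `f'' ≤ k² f` on a half-line `[r₀, ∞)` satisfies `f' ≥ -k f`: otherwise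
it would reach zero in finite time. -/
theorem neg_mul_le_deriv_of_forall_ge (hk : 0 ≤ k) {r₀ : ℝ} (hf : ∀ r ∈ Ici r₀, ContDiffAt ℝ 2 f r)
    (hpos : ∀ r ∈ Ici r₀, 0 < f r) (hf'' : ∀ r ∈ Ici r₀, deriv (deriv f) r ≤ k ^ 2 * f r) :
    -(k * f r₀) ≤ deriv f r₀ := by
  by_contra! hc
  set c := deriv f r₀ + k * f r₀ with hcdef
  have hc0 : c < 0 := by linarith
  have hanti := antitoneOn_exp_mul_deriv_sub (k := -k) (convex_Ici r₀) hf (by simpa using hf'')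
  have hder : ∀ r ∈ Ici r₀, deriv f r ≤ c := by
    intro r hr
    have h1 := hanti self_mem_Ici hr hr
    simp only at h1
    have h2 : Real.exp (-k * r) ≤ Real.exp (-k * r₀) :=
      Real.exp_le_exp.2 (by nlinarith [mem_Ici.1 hr])
    have h3 : Real.exp (-k * r₀) * c ≤ Real.exp (-k * r) * c :=
      mul_le_mul_of_nonpos_right h2 hc0.le
    have h4 : Real.exp (-k * r) * (deriv f r - -k * f r) ≤ Real.exp (-k * r) * c := by
      refine h1.trans (le_trans (le_of_eq ?_) h3)
      rw [hcdef]; ring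
    have h5 := le_of_mul_le_mul_left h4 (Real.exp_pos _)
    have := mul_nonneg hk (hpos r hr).le
    linarith
  have hd : ∀ r ∈ Ici r₀, DifferentiableAt ℝ f r := fun r hr ↦ (hf r hr).differentiableAt two_ne_zero
  have hlin : ∀ r ∈ Ici r₀, f r ≤ f r₀ + c * (r - r₀) := by
    intro r hr
    have := (convex_Ici r₀).image_sub_le_mul_sub_of_deriv_le (f := f) (C := c)
      (fun r hr ↦ (hd r hr).continuousAt.continuousWithinAt)
      (fun r hr ↦ (hd r (interior_subset hr)).differentiableWithinAt)
      (fun r hr ↦ hder r (interior_subset hr)) r₀ self_mem_Ici r hr hr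
    linarith
  have hr1 : r₀ + f r₀ / (-c) ∈ Ici r₀ :=
    le_add_of_nonneg_right (div_nonneg (hpos r₀ self_mem_Ici).le (by linarith))
  have h1 := hlin _ hr1
  have h2 := hpos _ hr1
  have h3 : c * (r₀ + f r₀ / (-c) - r₀) = -f r₀ := by
    field_simp [hc0.ne]
    ring
  linarith

/-- A positive function with `f'' ≤ k² f` on the whole line satisfies `|f'| ≤ k f`. -/
theorem sq_deriv_le_of_forall (hk : 0 ≤ k) (hf : ∀ r, ContDiffAt ℝ 2 f r) (hpos : ∀ r, 0 < f r)
    (hf'' : ∀ r, deriv (deriv f) r ≤ k ^ 2 * f r) (r : ℝ) : deriv f r ^ 2 ≤ k ^ 2 * f r ^ 2 := by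
  have h1 := neg_mul_le_deriv_of_forall_ge hk (r₀ := r) (fun r _ ↦ hf r) (fun r _ ↦ hpos r)
    (fun r _ ↦ hf'' r)
  have hd1 : deriv (fun x ↦ f (-x)) = fun x ↦ -deriv f (-x) := funext fun x ↦ deriv_comp_neg f x
  have hd2 (x) : deriv (deriv (fun x ↦ f (-x))) x = deriv (deriv f) (-x) := by
    rw [hd1, deriv.fun_neg, deriv_comp_neg, neg_neg]
  have h2 := neg_mul_le_deriv_of_forall_ge (f := fun x ↦ f (-x)) hk (r₀ := -r)
    (fun x _ ↦ (hf (-x)).comp x contDiff_neg.contDiffAt) (fun x _ ↦ hpos _)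
    (fun x _ ↦ by rw [hd2]; exact hf'' _)
  simp only [hd1, neg_neg] at h2
  nlinarith

/-- Let `f` be positive with `f'' ≤ k² f` on `(0, ∞)`. Unless `|f'| ≤ k f` at `r`, the function `f`
is increasing on `(0, r)` with `f'^2 - k² f^2` decreasing there. -/
theorem sq_deriv_le_or_of_Ioi (hk : 0 ≤ k) (hf : ∀ r ∈ Ioi (0 : ℝ), ContDiffAt ℝ 2 f r)
    (hpos : ∀ r ∈ Ioi (0 : ℝ), 0 < f r)
    (hf'' : ∀ r ∈ Ioi (0 : ℝ), deriv (deriv f) r ≤ k ^ 2 * f r) {r : ℝ} (hr : 0 < r) {C C' : ℝ}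
    (hkC : k ^ 2 ≤ C') (hC : C ≤ C') :
    deriv f r ^ 2 ≤ C' * f r ^ 2 ∨
      ∀ s ∈ Ioo 0 r, deriv f r ^ 2 - C' * f r ^ 2 ≤ deriv f s ^ 2 - C * f s ^ 2 := by
  have hlow := neg_mul_le_deriv_of_forall_ge hk (r₀ := r)
    (fun x hx ↦ hf x (hr.trans_le hx)) (fun x hx ↦ hpos x (hr.trans_le hx))
    (fun x hx ↦ hf'' x (hr.trans_le hx))
  by_cases hup : deriv f r ≤ k * f r
  · left
    have h1 : deriv f r ^ 2 ≤ k ^ 2 * f r ^ 2 := by nlinarith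
    exact h1.trans (mul_le_mul_of_nonneg_right hkC (sq_nonneg _))
  right
  have hanti := antitoneOn_exp_mul_deriv_sub (k := k) (convex_Ioi 0) hf hf''
  have hd (x) (hx : 0 < x) : HasDerivAt f (deriv f x) x :=
    ((hf x hx).differentiableAt two_ne_zero).hasDerivAt
  have hd' (x) (hx : 0 < x) : HasDerivAt (deriv f) (deriv (deriv f) x) x :=
    (differentiableAt_deriv (hf x hx)).hasDerivAt
  have hder : ∀ s ∈ Ioc 0 r, 0 ≤ deriv f s := by
    intro s hs
    have h1 := hanti hs.1 hr hs.2
    simp only at h1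
    by_contra! hneg
    have h2 : deriv f s - k * f s ≤ 0 := by
      have := mul_nonneg hk (hpos s hs.1).le
      linarith
    have h3 := mul_nonpos_of_nonneg_of_nonpos (Real.exp_pos (k * s)).le h2
    have h4 := mul_pos (Real.exp_pos (k * r)) (sub_pos.2 (not_le.1 hup))
    linarith
  intro s hs
  have hsub : Icc s r ⊆ Ioc 0 r := fun x hx ↦ ⟨hs.1.trans_le hx.1, hx.2⟩
  have hmono : MonotoneOn f (Icc s r) :=
    monotoneOn_of_deriv_nonneg (convex_Icc s r)
      (fun x hx ↦ (hd x (hsub hx).1).continuousAt.continuousWithinAt)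
      (fun x hx ↦ (hd x (hsub (interior_subset hx)).1).differentiableAt.differentiableWithinAt)
      (fun x hx ↦ hder x (hsub (interior_subset hx)))
  have hq (x) (hx : 0 < x) : HasDerivAt (fun x ↦ deriv f x ^ 2 - k ^ 2 * f x ^ 2)
      (2 * deriv f x * (deriv (deriv f) x - k ^ 2 * f x)) x := by
    refine (((hd' x hx).pow 2).sub (((hd x hx).pow 2).const_mul (k ^ 2))).congr_deriv ?_
    push_cast
    ring
  have hanti' : AntitoneOn (fun x ↦ deriv f x ^ 2 - k ^ 2 * f x ^ 2) (Icc s r) := by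
    refine antitoneOn_of_deriv_nonpos (convex_Icc s r)
      (fun x hx ↦ (hq x (hsub hx).1).continuousAt.continuousWithinAt)
      (fun x hx ↦ (hq x (hsub (interior_subset hx)).1).differentiableAt.differentiableWithinAt)
      fun x hx ↦ ?_
    have hx' := hsub (interior_subset hx)
    rw [(hq x hx'.1).deriv]
    exact mul_nonpos_of_nonneg_of_nonpos (mul_nonneg two_pos.le (hder x hx'))
      (sub_nonpos.2 (hf'' x hx'.1))
  have h1 := hanti' (left_mem_Icc.2 hs.2.le) (right_mem_Icc.2 hs.2.le) hs.2.le
  simp only at h1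
  have h2 := hmono (left_mem_Icc.2 hs.2.le) (right_mem_Icc.2 hs.2.le) hs.2.le
  have h3 : f s ^ 2 ≤ f r ^ 2 := pow_le_pow_left₀ (hpos s hs.1).le h2 2
  nlinarith [mul_nonneg (sub_nonneg.2 hkC) (sub_nonneg.2 h3), mul_nonneg (sub_nonneg.2 hC)
    (sq_nonneg (f s))]

end WarpingFunction

/-! ### Curvature bounds in a parametrization -/

section Transport

set_option maxSynthPendingDepth 3

variable {E : Type*} [NormedAddCommGroup E] [NormedSpace ℝ E] [FiniteDimensional ℝ E]
  {H : Type*} [TopologicalSpace H] {I : ModelWithCorners ℝ E H}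
  {M : Type*} [TopologicalSpace M] [ChartedSpace H M] [IsManifold I ∞ M]
  {F : Type*} [NormedAddCommGroup F] [NormedSpace ℝ F] [FiniteDimensional ℝ F]

theorem CurvatureGEAt.mono {G : F → F →L[ℝ] F →L[ℝ] ℝ} {y : F} {κ κ' : ℝ}
    (h : CurvatureGEAt G y κ) (hG : IsInner (G y)) (hκ : κ' ≤ κ) : CurvatureGEAt G y κ' :=
  fun θ ↦ (mul_le_mul_of_nonneg_right hκ (bivectorForm_nonneg hG θ)).trans (h θ)

theorem CurvatureGEAt.congr {G G' : F → F →L[ℝ] F →L[ℝ] ℝ} {y : F} {κ : ℝ}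
    (h : CurvatureGEAt G y κ) (hG : G =ᶠ[𝓝 y] G') : CurvatureGEAt G' y κ := by
  intro θ
  rw [← hG.self_of_nhds, ← curvatureForm_congr hG]
  exact h θ

/-- The curvature operator of the Riemannian metric `g` at `x` is bounded below by `κ • id`. -/
def CurvatureOperatorGEAt (g : RMetric I M) (x : M) (κ : ℝ) : Prop :=
  ∀ θ : ⋀[ℝ]^2 E,
    κ * bivectorForm (metricAt g x) θ θ ≤ bivectorForm (metricAt g x) (curvatureOperator g x θ) θ

theorem CurvatureOperatorGEAt.mono {g : RMetric I M} {x : M} {κ κ' : ℝ}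
    (h : CurvatureOperatorGEAt g x κ) (hκ : κ' ≤ κ) : CurvatureOperatorGEAt g x κ' :=
  fun θ ↦ (mul_le_mul_of_nonneg_right hκ (bivectorForm_nonneg (isInner_metricAt g x) θ)).trans (h θ)

variable [I.Boundaryless]

/-- Lower bounds for the curvature operator can be checked in any parametrization. -/
theorem curvatureOperatorGEAt_iff (g : RMetric I M) {ψ : F → M} {s : Set F} (hs : IsOpen s)
    (hψ : ContMDiffOn 𝓘(ℝ, F) I ∞ ψ s) {y : F} (hy : y ∈ s) (hinv : (paramDeriv I ψ y).IsInvertible)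
    (κ : ℝ) :
    CurvatureOperatorGEAt g (ψ y) κ ↔ CurvatureGEAt (pullbackMetric g ψ) y κ := by
  let D : ⋀[ℝ]^2 F →ₗ[ℝ] ⋀[ℝ]^2 E := exteriorPower.map 2 (paramDeriv I ψ y).toLinearMap
  have hD : Function.Surjective D := exteriorPower.map_surjective hinv.surjective
  have hi : IsInner (pullbackMetric g ψ y) := isInner_pullbackMetric g hinv.injective
  have h1 : (bivectorForm (metricAt g (ψ y))).compl₁₂ D D = bivectorForm (pullbackMetric g ψ y) :=
    bivector_bilin_ext fun u v w z ↦ by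
      simp only [D, LinearMap.compl₁₂_apply, map_wedge, bivectorForm_wedge]
      rfl
  have h2 : (bivectorForm (metricAt g (ψ y)) ∘ₗ curvatureOperator g (ψ y)).compl₁₂ D D =
      curvatureForm (pullbackMetric g ψ) y :=
    bivector_bilin_ext fun u v w z ↦ by
      simp only [D, LinearMap.compl₁₂_apply, map_wedge, LinearMap.comp_apply]
      rw [curvatureForm_wedge hi, bivectorForm_curvatureOperator]
      simp only [ContinuousLinearMap.coe_coe, curvature_paramDeriv g hs hψ hy hinv]
      rfl
  constructor
  · intro h θ
    rw [← h1, ← h2]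
    exact h (D θ)
  · intro h θ
    obtain ⟨η, rfl⟩ := hD θ
    have := h η
    rwa [← h1, ← h2] at this

/-- The curvature operator of a smooth metric is locally bounded below. -/
theorem eventually_curvatureOperatorGEAt (g : RMetric I M) (o : M) :
    ∃ C : ℝ, ∀ᶠ x in 𝓝 o, CurvatureOperatorGEAt g x (-C) := by
  have : IsManifold I 1 M := .of_le (n := ∞) (by norm_num)
  have hopen : IsOpen (extChartAt I o).target := isOpen_extChartAt_target o
  have htarget : (extChartAt I o).target ∈ 𝓝 (extChartAt I o o) := extChartAt_target_mem_nhds o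
  have hσ : ContMDiffOn 𝓘(ℝ, E) I ∞ (extChartAt I o).symm (extChartAt I o).target :=
    contMDiffOn_extChartAt_symm o
  have hG : ContDiffAt ℝ ∞ (pullbackMetric g (extChartAt I o).symm) (extChartAt I o o) :=
    (contDiffOn_pullbackMetric g hopen hσ).contDiffAt htarget
  obtain ⟨C, hC⟩ := eventually_curvatureGEAt (hG.of_le ENat.LEInfty.out) <| by
    filter_upwards [htarget] with z hz
    exact isInner_pullbackMetric g (isInvertible_paramDeriv_extChartAt_symm hz).injective
  refine ⟨C, ?_⟩
  have hc : ContinuousAt (extChartAt I o) o := continuousAt_extChartAt o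
  filter_upwards [hc.eventually hC, extChartAt_source_mem_nhds (I := I) o] with x hx hxs
  have hxt := (extChartAt I o).map_source hxs
  have := (curvatureOperatorGEAt_iff g hopen hσ hxt
    (isInvertible_paramDeriv_extChartAt_symm hxt) (-C)).2 hx
  rwa [(extChartAt I o).left_inv hxs] at this

/-- The Ricci curvature can be computed in any parametrization. -/
theorem ricci_paramDeriv (g : RMetric I M) {ψ : F → M} {s : Set F} (hs : IsOpen s)
    (hψ : ContMDiffOn 𝓘(ℝ, F) I ∞ ψ s) {y : F} (hy : y ∈ s) (hinv : (paramDeriv I ψ y).IsInvertible)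
    (u v : F) (T : F →ₗ[ℝ] F) (hT : ∀ w, T w = curvatureEndo (pullbackMetric g ψ) y w u v) :
    ricci g (ψ y) (paramDeriv I ψ y u) (paramDeriv I ψ y v) = LinearMap.trace ℝ F T := by
  obtain ⟨e, he⟩ := hinv
  rw [ricci, ← LinearMap.trace_conj' T e.toLinearEquiv]
  congr 1
  ext w
  obtain ⟨w, rfl⟩ := e.surjective w
  have h := curvature_paramDeriv g hs hψ hy ⟨e, he⟩ w u v
  rw [← he] at h ⊢
  simpa [LinearEquiv.conj_apply, hT] using h

end Transport

/-! ### Parametrizations of a warped product -/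

section WarpedManifold

set_option maxSynthPendingDepth 3

variable {E : Type*} [NormedAddCommGroup E] [NormedSpace ℝ E]
  {H : Type*} [TopologicalSpace H] {I : ModelWithCorners ℝ E H}
  {M : Type*} [TopologicalSpace M] [ChartedSpace H M] [IsManifold I ∞ M]
  {E' : Type*} [NormedAddCommGroup E'] [NormedSpace ℝ E']
  {H' : Type*} [TopologicalSpace H'] {I' : ModelWithCorners ℝ E' H'}
  {N : Type*} [TopologicalSpace N] [ChartedSpace H' N]

variable (I') in
/-- The parametrization of a warped product over `J × N` given by the preferred chart of `N`
at `p`. -/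
def warpedParam (Φ : OpenPartialHomeomorph (ℝ × N) M) (p : N) (z : ℝ × E') : M :=
  Φ (z.1, (extChartAt I' p).symm z.2)

variable (I') in
/-- The domain of `warpedParam`. -/
def warpedDomain (J : Set ℝ) (p : N) : Set (ℝ × E') := J ×ˢ (extChartAt I' p).target

theorem isOpen_warpedDomain [I'.Boundaryless] {J : Set ℝ} (hJ : IsOpen J) (p : N) :
    IsOpen (warpedDomain I' J p) :=
  hJ.prod (isOpen_extChartAt_target p)

variable [IsManifold I' ∞ N]

namespace IsWarpedProduct

variable {g : RMetric I M} {h : RMetric I' N} {f : ℝ → ℝ} {J : Set ℝ}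
  {Φ : OpenPartialHomeomorph (ℝ × N) M}

theorem mapsTo_warpedDomain (hΦ : IsWarpedProduct g h f J Φ) (p : N) :
    MapsTo (fun z : ℝ × E' ↦ (z.1, (extChartAt I' p).symm z.2)) (warpedDomain I' J p) Φ.source :=
  fun z hz ↦ by
    rw [hΦ.source_eq]
    exact ⟨hz.1, mem_univ _⟩

theorem mdifferentiable (hΦ : IsWarpedProduct g h f J Φ) :
    Φ.MDifferentiable (𝓘(ℝ, ℝ).prod I') I :=
  ⟨hΦ.smooth.mdifferentiableOn (by simp), hΦ.smooth_symm.mdifferentiableOn (by simp)⟩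

theorem contMDiffOn_warpedParam (hΦ : IsWarpedProduct g h f J Φ) (p : N) :
    ContMDiffOn 𝓘(ℝ, ℝ × E') I ∞ (warpedParam I' Φ p) (warpedDomain I' J p) := by
  have h1 : ContMDiffOn 𝓘(ℝ, ℝ × E') 𝓘(ℝ, ℝ) ∞ (Prod.fst : ℝ × E' → ℝ) (warpedDomain I' J p) :=
    contDiff_fst.contMDiff.contMDiffOn
  have h2 : ContMDiffOn 𝓘(ℝ, ℝ × E') I' ∞ (fun z : ℝ × E' ↦ (extChartAt I' p).symm z.2)
      (warpedDomain I' J p) :=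
    (contMDiffOn_extChartAt_symm p).comp
      (contDiff_snd.contMDiff.contMDiffOn (s := warpedDomain I' J p)) fun z hz ↦ hz.2
  exact hΦ.smooth.comp (h1.prodMk h2) (hΦ.mapsTo_warpedDomain p)

variable [I'.Boundaryless]

theorem paramDeriv_warpedParam (hΦ : IsWarpedProduct g h f J Φ) (p : N)
    {z : ℝ × E'} (hz : z ∈ warpedDomain I' J p) (X : ℝ × E') :
    paramDeriv I (warpedParam I' Φ p) z X =
      mfderiv (𝓘(ℝ, ℝ).prod I') I Φ (z.1, (extChartAt I' p).symm z.2)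
        ((X.1, paramDeriv I' (extChartAt I' p).symm z.2 X.2) : ℝ × E') := by
  have hσ : MDifferentiableAt 𝓘(ℝ, E') I' (extChartAt I' p).symm z.2 :=
    ((contMDiffOn_extChartAt_symm (n := ∞) p).contMDiffAt
      ((isOpen_extChartAt_target p).mem_nhds hz.2)).mdifferentiableAt (by simp)
  have hsnd : DifferentiableAt ℝ (Prod.snd : ℝ × E' → E') z := differentiableAt_snd
  have h1 : MDifferentiableAt 𝓘(ℝ, ℝ × E') 𝓘(ℝ, ℝ) (Prod.fst : ℝ × E' → ℝ) z :=
    differentiableAt_fst.mdifferentiableAt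
  have h2 : MDifferentiableAt 𝓘(ℝ, ℝ × E') I' ((extChartAt I' p).symm ∘ Prod.snd) z :=
    hσ.comp z hsnd.mdifferentiableAt
  have h3 : MDifferentiableAt (𝓘(ℝ, ℝ).prod I') I Φ (z.1, (extChartAt I' p).symm z.2) :=
    hΦ.mdifferentiable.mdifferentiableAt (hΦ.mapsTo_warpedDomain p hz)
  have h4 : paramDeriv I' ((extChartAt I' p).symm ∘ Prod.snd) z =
      (paramDeriv I' (extChartAt I' p).symm z.2).comp (fderiv ℝ Prod.snd z) :=
    paramDeriv_comp hσ hsnd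
  have h5 := mfderiv_comp z h3 (h1.prodMk h2)
  have h6 : mfderiv 𝓘(ℝ, ℝ × E') (𝓘(ℝ, ℝ).prod I')
      (fun z : ℝ × E' ↦ (z.1, ((extChartAt I' p).symm ∘ Prod.snd) z)) z = _ := mfderiv_prodMk h1 h2
  have h7 : paramDeriv I (warpedParam I' Φ p) z = _ := h5
  have h8 : mfderiv 𝓘(ℝ, ℝ × E') 𝓘(ℝ, ℝ) (Prod.fst : ℝ × E' → ℝ) z =
      ContinuousLinearMap.fst ℝ ℝ E' := by
    rw [mfderiv_eq_fderiv, fderiv_fst]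
  rw [fderiv_snd] at h4
  have h9 : mfderiv 𝓘(ℝ, ℝ × E') (𝓘(ℝ, ℝ).prod I')
      (fun z : ℝ × E' ↦ (z.1, ((extChartAt I' p).symm ∘ Prod.snd) z)) z X =
      ((X.1, paramDeriv I' (extChartAt I' p).symm z.2 X.2) : ℝ × E') := by
    rw [h6, h8]
    exact congrArg (fun L : ℝ × E' →L[ℝ] E' ↦ ((X.1, L X) : ℝ × E')) h4
  rw [h7]
  exact congrArg (mfderiv (𝓘(ℝ, ℝ).prod I') I Φ (z.1, (extChartAt I' p).symm z.2)) h9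

/-- In the coordinates `warpedParam` the metric is a warped product with the metric of `N` in the
preferred chart. -/
theorem pullbackMetric_warpedParam (hΦ : IsWarpedProduct g h f J Φ) (p : N)
    {z : ℝ × E'} (hz : z ∈ warpedDomain I' J p) :
    pullbackMetric g (warpedParam I' Φ p) z = warpedMetric f (metricInChart h p) z := by
  refine ContinuousLinearMap.ext fun X ↦ ContinuousLinearMap.ext fun Y ↦ ?_
  have := hΦ.metric_eq z.1 hz.1 ((extChartAt I' p).symm z.2) X.1 Y.1
    (paramDeriv I' (extChartAt I' p).symm z.2 X.2) (paramDeriv I' (extChartAt I' p).symm z.2 Y.2)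
  rw [← hΦ.paramDeriv_warpedParam p hz, ← hΦ.paramDeriv_warpedParam p hz] at this
  exact this

theorem isInvertible_paramDeriv_warpedParam [FiniteDimensional ℝ E] [FiniteDimensional ℝ E']
    (hΦ : IsWarpedProduct g h f J Φ) (p : N) {z : ℝ × E'} (hz : z ∈ warpedDomain I' J p) :
    (paramDeriv I (warpedParam I' Φ p) z).IsInvertible := by
  have : IsManifold I' 1 N := .of_le (n := ∞) (by norm_num)
  have hb1 := hΦ.mdifferentiable.mfderiv_bijective (hΦ.mapsTo_warpedDomain p hz)
  have hb2 := (isInvertible_paramDeriv_extChartAt_symm (I := I') hz.2).bijective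
  have hb : Function.Bijective (paramDeriv I (warpedParam I' Φ p) z) := by
    have heq : ⇑(paramDeriv I (warpedParam I' Φ p) z) =
        (fun Y : ℝ × E' ↦ mfderiv (𝓘(ℝ, ℝ).prod I') I Φ (z.1, (extChartAt I' p).symm z.2) Y) ∘
        (Prod.map id (paramDeriv I' (extChartAt I' p).symm z.2)) :=
      funext fun X ↦ hΦ.paramDeriv_warpedParam p hz X
    rw [heq]
    exact hb1.comp (Function.bijective_id.prodMap hb2)
  exact ⟨(LinearEquiv.ofBijective (paramDeriv I (warpedParam I' Φ p) z).toLinearMap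
    hb).toContinuousLinearEquiv, ContinuousLinearMap.ext fun _ ↦ rfl⟩

end IsWarpedProduct

end WarpedManifold

/-! ### Completeness and the apex -/

section Completeness

set_option maxSynthPendingDepth 3

variable {E : Type*} [NormedAddCommGroup E] [NormedSpace ℝ E]
  {H : Type*} [TopologicalSpace H] {I : ModelWithCorners ℝ E H}
  {M : Type*} [TopologicalSpace M] [ChartedSpace H M] [IsManifold I ∞ M]
  {E' : Type*} [NormedAddCommGroup E'] [NormedSpace ℝ E']
  {H' : Type*} [TopologicalSpace H'] {I' : ModelWithCorners ℝ E' H'}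
  {N : Type*} [TopologicalSpace N] [ChartedSpace H' N] [IsManifold I' ∞ N]
  {g : RMetric I M} {h : RMetric I' N} {f : ℝ → ℝ} {J : Set ℝ}
  {Φ : OpenPartialHomeomorph (ℝ × N) M}

open scoped Bundle in
/-- A path of unit speed is at least as long as the distance between its end points. -/
theorem riemDist_le_of_unit_speed (g : RMetric I M) {γ : ℝ → M} {a b : ℝ} (hab : a ≤ b)
    (hγ : ContMDiffOn 𝓘(ℝ, ℝ) I 1 γ (Icc a b))
    (hspeed : ∀ t ∈ Icc a b, g.inner (γ t) (mfderiv 𝓘(ℝ, ℝ) I γ t (1 : ℝ))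
      (mfderiv 𝓘(ℝ, ℝ) I γ t (1 : ℝ)) = 1) :
    riemDist g (γ a) (γ b) ≤ ENNReal.ofReal (b - a) := by
  let _ : Bundle.RiemannianBundle (fun x : M ↦ TangentSpace I x) := ⟨g.toRiemannianMetric⟩
  have h1 : Manifold.riemannianEDist I (γ a) (γ b) ≤ Manifold.pathELength I γ a b :=
    Manifold.riemannianEDist_le_pathELength hγ rfl rfl hab
  refine h1.trans ?_
  rw [Manifold.pathELength_eq_lintegral_mfderiv_Icc]
  have h2 : ∀ t ∈ Icc a b, ‖mfderiv 𝓘(ℝ, ℝ) I γ t (1 : ℝ)‖ₑ ≤ 1 := by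
    intro t ht
    have h3 : ‖mfderiv 𝓘(ℝ, ℝ) I γ t (1 : ℝ)‖ ^ 2 = 1 :=
      (real_inner_self_eq_norm_sq _).symm.trans (hspeed t ht)
    have h4 : ‖mfderiv 𝓘(ℝ, ℝ) I γ t (1 : ℝ)‖ = 1 := by
      rwa [pow_eq_one_iff_of_nonneg (norm_nonneg _) two_ne_zero] at h3
    rw [← ofReal_norm, h4, ENNReal.ofReal_one]
  refine (MeasureTheory.setLIntegral_mono measurable_const h2).trans ?_
  simp

open scoped Bundle in
theorem riemDist_comm (g : RMetric I M) (x y : M) : riemDist g x y = riemDist g y x := by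
  let _ : Bundle.RiemannianBundle (fun x : M ↦ TangentSpace I x) := ⟨g.toRiemannianMetric⟩
  exact Manifold.riemannianEDist_comm

theorem IsWarpedProduct.riemDist_radial_le (hΦ : IsWarpedProduct g h f J Φ) (p : N) {a b : ℝ}
    (hab : a ≤ b) (hJ : Icc a b ⊆ J) :
    riemDist g (Φ (a, p)) (Φ (b, p)) ≤ ENNReal.ofReal (b - a) := by
  have hmaps : ∀ t ∈ Icc a b, (t, p) ∈ Φ.source := fun t ht ↦ by
    rw [hΦ.source_eq]
    exact ⟨hJ ht, mem_univ _⟩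
  have hι : ContMDiff 𝓘(ℝ, ℝ) (𝓘(ℝ, ℝ).prod I') ∞ (fun t : ℝ ↦ (t, p)) :=
    contMDiff_id.prodMk contMDiff_const
  have hγ : ContMDiffOn 𝓘(ℝ, ℝ) I ∞ (fun t ↦ Φ (t, p)) (Icc a b) :=
    hΦ.smooth.comp hι.contMDiffOn hmaps
  refine riemDist_le_of_unit_speed (γ := fun t ↦ Φ (t, p)) g hab (hγ.of_le ENat.LEInfty.out)
    fun t ht ↦ ?_
  have h1 : mfderiv 𝓘(ℝ, ℝ) I (fun t ↦ Φ (t, p)) t = _ :=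
    mfderiv_comp t (hΦ.mdifferentiable.mdifferentiableAt (hmaps t ht))
      (hι.mdifferentiableAt (by simp))
  have h2 : mfderiv 𝓘(ℝ, ℝ) (𝓘(ℝ, ℝ).prod I') (fun t : ℝ ↦ (t, p)) t (1 : ℝ) =
      ((1, 0) : ℝ × E') := by
    rw [mfderiv_prod_left]
    rfl
  have h3 : mfderiv 𝓘(ℝ, ℝ) I (fun t ↦ Φ (t, p)) t (1 : ℝ) =
      mfderiv (𝓘(ℝ, ℝ).prod I') I Φ (t, p) ((1, 0) : ℝ × E') := by
    rw [h1]
    exact congrArg (mfderiv (𝓘(ℝ, ℝ).prod I') I Φ (t, p)) h2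
  rw [h3, hΦ.metric_eq t (hJ ht) p 1 1 0 0]
  have h4 : h.inner p (0 : E') (0 : E') = 0 := map_zero (h.inner p (0 : E'))
  rw [h4]
  ring

theorem IsWarpedProduct.contDiffAt_warp (hΦ : IsWarpedProduct g h f J Φ) (hJ : IsOpen J) {r : ℝ}
    (hr : r ∈ J) :
    ContDiffAt ℝ 2 f r :=
  (hΦ.smooth_warp.contDiffAt (hJ.mem_nhds hr)).of_le ENat.LEInfty.out

/-- In a complete warped product over `(0, ∞) × N` that is closed up by the point `o`, the radial
curves converge to `o`: they have finite length, and `r → 0` excludes all other limits. -/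
theorem IsWarpedProduct.tendsto_apex (hΦ : IsWarpedProduct g h f (Ioi 0) Φ)
    (hg : IsCompleteMetric g) {o : M} (ho : Φ.target = {o}ᶜ) (p : N) :
    Tendsto (fun n : ℕ ↦ Φ (1 / ((n : ℝ) + 1), p)) atTop (𝓝 o) := by
  have hpos (n : ℕ) : (0 : ℝ) < 1 / ((n : ℝ) + 1) := Nat.one_div_pos_of_nat
  have hmem (n : ℕ) : (1 / ((n : ℝ) + 1), p) ∈ Φ.source := by
    rw [hΦ.source_eq]
    exact ⟨hpos n, mem_univ _⟩
  have hle : ∀ m k : ℕ, m ≤ k → riemDist g (Φ (1 / ((m : ℝ) + 1), p)) (Φ (1 / ((k : ℝ) + 1), p)) ≤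
      ENNReal.ofReal (1 / ((m : ℝ) + 1)) := by
    intro m k hmk
    rw [riemDist_comm]
    refine (hΦ.riemDist_radial_le p (Nat.one_div_le_one_div hmk)
      fun t ht ↦ (hpos k).trans_le ht.1).trans (ENNReal.ofReal_le_ofReal ?_)
    linarith [hpos k]
  obtain ⟨x, hx⟩ := hg (fun n : ℕ ↦ Φ (1 / ((n : ℝ) + 1), p)) fun ε hε ↦ by
    have ht : Tendsto (fun n : ℕ ↦ ENNReal.ofReal (1 / ((n : ℝ) + 1))) atTop (𝓝 0) := by
      simpa using ENNReal.tendsto_ofReal (tendsto_one_div_add_atTop_nhds_zero_nat (𝕜 := ℝ))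
    obtain ⟨K, hK⟩ := eventually_atTop.1 (ht.eventually (gt_mem_nhds hε))
    refine ⟨K, fun m hm k hk ↦ ?_⟩
    rcases le_total m k with hmk | hmk
    · exact (hle m k hmk).trans_lt (hK m hm)
    · rw [riemDist_comm]
      exact (hle k m hmk).trans_lt (hK k hk)
  have hxo : x = o := by
    by_contra hne
    have hxt : x ∈ Φ.target := by rw [ho]; exact hne
    have h1 : Tendsto (fun n : ℕ ↦ (Φ.symm (Φ (1 / ((n : ℝ) + 1), p))).1) atTop
        (𝓝 (Φ.symm x).1) :=
      (continuous_fst.tendsto _).comp ((Φ.symm.continuousAt hxt).tendsto.comp hx)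
    simp only [Φ.left_inv (hmem _)] at h1
    have h2 := tendsto_nhds_unique h1 tendsto_one_div_add_atTop_nhds_zero_nat
    have h3 := Φ.map_target hxt
    rw [hΦ.source_eq] at h3
    exact (mem_Ioi.1 h3.1).ne' h2
  exact hxo ▸ hx

theorem eventually_isInner_metricInChart [I'.Boundaryless] (h : RMetric I' N) (p : N) :
    ∀ᶠ y in 𝓝 (extChartAt I' p p), IsInner (metricInChart h p y) := by
  have : IsManifold I' 1 N := .of_le (n := ∞) (by norm_num)
  filter_upwards [extChartAt_target_mem_nhds (I := I') p] with y hy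
  exact isInner_pullbackMetric h (isInvertible_paramDeriv_extChartAt_symm hy).injective

end Completeness

/-! ### The curvature of a warped product -/

section WarpedCurvature

set_option maxSynthPendingDepth 3

variable {E : Type*} [NormedAddCommGroup E] [NormedSpace ℝ E] [FiniteDimensional ℝ E]
  {H : Type*} [TopologicalSpace H] {I : ModelWithCorners ℝ E H} [I.Boundaryless]
  {M : Type*} [TopologicalSpace M] [ChartedSpace H M] [IsManifold I ∞ M]
  {E' : Type*} [NormedAddCommGroup E'] [NormedSpace ℝ E'] [FiniteDimensional ℝ E']
  {H' : Type*} [TopologicalSpace H'] {I' : ModelWithCorners ℝ E' H'} [I'.Boundaryless]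
  {N : Type*} [TopologicalSpace N] [ChartedSpace H' N] [IsManifold I' ∞ N]
  {g : RMetric I M} {h : RMetric I' N} {f : ℝ → ℝ} {J : Set ℝ}
  {Φ : OpenPartialHomeomorph (ℝ × N) M}

theorem contDiffAt_metricInChart (h : RMetric I' N) (p : N) :
    ContDiffAt ℝ ∞ (metricInChart h p) (extChartAt I' p p) :=
  (contDiffOn_pullbackMetric h (isOpen_extChartAt_target p)
    (contMDiffOn_extChartAt_symm p)).contDiffAt (extChartAt_target_mem_nhds p)

theorem curvatureOperatorGEAt_iff_metricInChart (h : RMetric I' N) (p : N) (κ : ℝ) :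
    CurvatureOperatorGEAt h p κ ↔ CurvatureGEAt (metricInChart h p) (extChartAt I' p p) κ := by
  have : IsManifold I' 1 N := .of_le (n := ∞) (by norm_num)
  have := curvatureOperatorGEAt_iff h (isOpen_extChartAt_target p) (contMDiffOn_extChartAt_symm p)
    (mem_extChartAt_target p) (isInvertible_paramDeriv_extChartAt_symm (mem_extChartAt_target p)) κ
  rwa [extChartAt_to_inv] at this

namespace IsWarpedProduct

theorem curvatureOperatorGEAt_iff (hΦ : IsWarpedProduct g h f J Φ) (hJ : IsOpen J) {r : ℝ}
    (hr : r ∈ J) (p : N) (κ : ℝ) : CurvatureOperatorGEAt g (Φ (r, p)) κ ↔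
      CurvatureGEAt (warpedMetric f (metricInChart h p)) (r, extChartAt I' p p) κ := by
  have hz : (r, extChartAt I' p p) ∈ warpedDomain I' J p := ⟨hr, mem_extChartAt_target p⟩
  have hopen := isOpen_warpedDomain (I' := I') hJ p
  have h1 := RiemGeom.curvatureOperatorGEAt_iff g hopen (hΦ.contMDiffOn_warpedParam p) hz
    (hΦ.isInvertible_paramDeriv_warpedParam p hz) κ
  have h2 : warpedParam I' Φ p (r, extChartAt I' p p) = Φ (r, p) := by
    simp [warpedParam]
  have h3 : pullbackMetric g (warpedParam I' Φ p) =ᶠ[𝓝 (r, extChartAt I' p p)]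
      warpedMetric f (metricInChart h p) := by
    filter_upwards [hopen.mem_nhds hz] with z hz using hΦ.pullbackMetric_warpedParam p hz
  rw [h2] at h1
  exact h1.trans ⟨fun H ↦ H.congr h3, fun H ↦ H.congr h3.symm⟩

/-- The radial Ricci curvature of a warped product is `-n f'' / f`, where `n = dim N`. -/
theorem ricci_radial (hΦ : IsWarpedProduct g h f J Φ) (hJ : IsOpen J) {r : ℝ} (hr : r ∈ J) (p : N) :
    ricci g (Φ (r, p)) (radial I I' Φ r p) (radial I I' Φ r p) =
      -(Module.finrank ℝ E' * (deriv (deriv f) r / f r)) := by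
  -- `p` is replaced by the equal point `p'`, as the type of `radial` depends on the base point
  obtain ⟨p', hp'⟩ : ∃ p', p' = (extChartAt I' p).symm (extChartAt I' p p) := ⟨_, rfl⟩
  have hpp : p' = p := hp'.trans (extChartAt_to_inv p)
  have hz : (r, extChartAt I' p p) ∈ warpedDomain I' J p := ⟨hr, mem_extChartAt_target p⟩
  have hopen := isOpen_warpedDomain (I' := I') hJ p
  have h3 : pullbackMetric g (warpedParam I' Φ p) =ᶠ[𝓝 (r, extChartAt I' p p)]
      warpedMetric f (metricInChart h p) := by
    filter_upwards [hopen.mem_nhds hz] with z hz using hΦ.pullbackMetric_warpedParam p hz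
  let T : (ℝ × E') →ₗ[ℝ] (ℝ × E') :=
    { toFun := fun w ↦ curvatureEndo (pullbackMetric g (warpedParam I' Φ p))
        (r, extChartAt I' p p) w (1, 0) (1, 0)
      map_add' := fun a b ↦ by
        simp only [curvatureEndo, map_add, add_apply, sub_apply, ContinuousLinearMap.comp_apply]
        abel
      map_smul' := fun c a ↦ by
        simp only [curvatureEndo, map_smul, add_apply, sub_apply, ContinuousLinearMap.comp_apply,
          smul_apply, RingHom.id_apply, smul_sub, smul_add] }
  have h4 := ricci_paramDeriv g hopen (hΦ.contMDiffOn_warpedParam p) hz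
    (hΦ.isInvertible_paramDeriv_warpedParam p hz) (1, 0) (1, 0) T fun w ↦ rfl
  have h5 := trace_curvatureEndo_warpedMetric (z := (r, extChartAt I' p p))
    (hΦ.contDiffAt_warp hJ hr) ((contDiffAt_metricInChart h p).of_le ENat.LEInfty.out)
    (hΦ.warp_pos r hr) (eventually_isInner_metricInChart h p) T
    fun X ↦ by rw [← curvatureEndo_congr h3]; rfl
  have h6 : paramDeriv I (warpedParam I' Φ p) (r, extChartAt I' p p) (1, 0) =
      radial I I' Φ r p' := by
    rw [hΦ.paramDeriv_warpedParam p hz, hp']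
    simp only [map_zero]
    rfl
  rw [h5, h6] at h4
  have h7 : ricci g (Φ (r, p')) (radial I I' Φ r p') (radial I I' Φ r p') =
      -(Module.finrank ℝ E' * (deriv (deriv f) r / f r)) := by
    rw [← h4, hp']
    rfl
  rwa [hpp] at h7

end IsWarpedProduct

end WarpedCurvature

/-! ### Lower bounds for the curvature operator of a warped product -/

section LowerBounds

set_option maxSynthPendingDepth 3

variable {E : Type*} [NormedAddCommGroup E] [NormedSpace ℝ E] [FiniteDimensional ℝ E]
  {H : Type*} [TopologicalSpace H] {I : ModelWithCorners ℝ E H} [I.Boundaryless]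
  {M : Type*} [TopologicalSpace M] [ChartedSpace H M] [IsManifold I ∞ M]
  {E' : Type*} [NormedAddCommGroup E'] [NormedSpace ℝ E'] [FiniteDimensional ℝ E']
  {H' : Type*} [TopologicalSpace H'] {I' : ModelWithCorners ℝ E' H'} [I'.Boundaryless]
  {N : Type*} [TopologicalSpace N] [ChartedSpace H' N] [IsManifold I' ∞ N]
  {g : RMetric I M} {h : RMetric I' N} {f : ℝ → ℝ} {J : Set ℝ}
  {Φ : OpenPartialHomeomorph (ℝ × N) M}

namespace IsWarpedProduct

/-- If `N` is zero-dimensional, then `M` is one-dimensional and has no bivectors. -/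
theorem curvatureOperatorGEAt_of_subsingleton [Subsingleton E'] (hΦ : IsWarpedProduct g h f J Φ)
    (hJ : IsOpen J) {r : ℝ} (hr : r ∈ J) (p : N) (κ : ℝ) :
    CurvatureOperatorGEAt g (Φ (r, p)) κ := by
  rw [hΦ.curvatureOperatorGEAt_iff hJ hr]
  intro θ
  rw [bivector_eq_zero_of_subsingleton θ]
  simp

theorem deriv_deriv_le_of_ricci (hΦ : IsWarpedProduct g h f J Φ) (hJ : IsOpen J)
    (hn : 0 < Module.finrank ℝ E') {C r : ℝ} (hr : r ∈ J) (p : N)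
    (hRic : -C ^ 2 ≤ ricci g (Φ (r, p)) (radial I I' Φ r p) (radial I I' Φ r p)) :
    deriv (deriv f) r ≤ C ^ 2 / Module.finrank ℝ E' * f r := by
  rw [hΦ.ricci_radial hJ hr p] at hRic
  have hn' : (0 : ℝ) < Module.finrank ℝ E' := Nat.cast_pos.2 hn
  rw [← div_le_iff₀ (hΦ.warp_pos r hr), le_div_iff₀ hn']
  linarith

/-- The curvature operator of a warped product over `J × N` is at least `-C`, if `f'' ≤ C f` and
the curvature operator of `N` is at least `f'^2 - C f^2`. -/
theorem curvatureOperatorGEAt_of_fibre (hΦ : IsWarpedProduct g h f J Φ) (hJ : IsOpen J) {r C : ℝ}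
    (hr : r ∈ J) {p : N} (hf'' : deriv (deriv f) r ≤ C * f r)
    (hfib : CurvatureOperatorGEAt h p (deriv f r ^ 2 - C * f r ^ 2)) :
    CurvatureOperatorGEAt g (Φ (r, p)) (-C) :=
  (hΦ.curvatureOperatorGEAt_iff hJ hr p (-C)).2 <|
    curvatureGEAt_warpedMetric (z := (r, extChartAt I' p p)) (hΦ.contDiffAt_warp hJ hr)
      ((contDiffAt_metricInChart h p).of_le ENat.LEInfty.out) (hΦ.warp_pos r hr)
      (eventually_isInner_metricInChart h p) hf''
      ((curvatureOperatorGEAt_iff_metricInChart h p _).1 hfib)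

theorem curvatureOperatorGEAt_fibre (hΦ : IsWarpedProduct g h f J Φ) (hJ : IsOpen J) {r C : ℝ}
    (hr : r ∈ J) {p : N} (hg : CurvatureOperatorGEAt g (Φ (r, p)) (-C)) :
    CurvatureOperatorGEAt h p (deriv f r ^ 2 - C * f r ^ 2) :=
  (curvatureOperatorGEAt_iff_metricInChart h p _).2 <|
    ((hΦ.curvatureOperatorGEAt_iff hJ hr p (-C)).1 hg).fibre (z := (r, extChartAt I' p p))
      (hΦ.contDiffAt_warp hJ hr) ((contDiffAt_metricInChart h p).of_le ENat.LEInfty.out)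
      (hΦ.warp_pos r hr) (eventually_isInner_metricInChart h p)

/-- The curvature bound for a warped product over the whole line. -/
theorem curvatureOperatorGEAt_of_univ (hΦ : IsWarpedProduct g h f univ Φ) {k : ℝ} (hk : 0 ≤ k)
    (hf'' : ∀ r, deriv (deriv f) r ≤ k ^ 2 * f r) {p : N} (hp : CurvatureOperatorGEAt h p 0)
    (r : ℝ) : CurvatureOperatorGEAt g (Φ (r, p)) (-(k ^ 2)) := by
  refine hΦ.curvatureOperatorGEAt_of_fibre isOpen_univ (mem_univ r) (hf'' r) (hp.mono ?_)
  have := sq_deriv_le_of_forall hk (fun r ↦ hΦ.contDiffAt_warp isOpen_univ (mem_univ r))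
    (fun r ↦ hΦ.warp_pos r (mem_univ r)) hf'' r
  linarith

/-- The curvature bound for a complete warped product over the half-line, closed up by a point `o`
near which the curvature operator is at least `-C`. The curvature near `o` bounds the curvature of
the fibre from below along the radial curves, which converge to `o`. -/
theorem curvatureOperatorGEAt_of_Ioi (hΦ : IsWarpedProduct g h f (Ioi 0) Φ)
    (hg : IsCompleteMetric g) {o : M} (ho : Φ.target = {o}ᶜ) {C : ℝ}
    (hC : ∀ᶠ x in 𝓝 o, CurvatureOperatorGEAt g x (-C)) {k : ℝ} (hk : 0 ≤ k)
    (hf'' : ∀ r ∈ Ioi (0 : ℝ), deriv (deriv f) r ≤ k ^ 2 * f r) {p : N}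
    (hp : CurvatureOperatorGEAt h p 0) {r : ℝ} (hr : 0 < r) :
    CurvatureOperatorGEAt g (Φ (r, p)) (-max C (k ^ 2)) := by
  have hpos := hΦ.warp_pos r hr
  refine hΦ.curvatureOperatorGEAt_of_fibre isOpen_Ioi hr
    ((hf'' r hr).trans (mul_le_mul_of_nonneg_right (le_max_right _ _) hpos.le)) ?_
  rcases sq_deriv_le_or_of_Ioi hk (fun r hr ↦ hΦ.contDiffAt_warp isOpen_Ioi hr) hΦ.warp_pos hf'' hr
    (le_max_right C (k ^ 2)) (le_max_left C (k ^ 2)) with hle | hle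
  · exact hp.mono (by linarith)
  · have h0 : ∀ᶠ n : ℕ in atTop, 1 / ((n : ℝ) + 1) < r :=
      (tendsto_one_div_add_atTop_nhds_zero_nat (𝕜 := ℝ)).eventually (gt_mem_nhds hr)
    obtain ⟨n, hn, hnr⟩ := (((hΦ.tendsto_apex hg ho p).eventually hC).and h0).exists
    have hs : 1 / ((n : ℝ) + 1) ∈ Ioo 0 r := ⟨Nat.one_div_pos_of_nat, hnr⟩
    exact (hΦ.curvatureOperatorGEAt_fibre isOpen_Ioi hs.1 hn).mono (hle _ hs)

end IsWarpedProduct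

end LowerBounds

end RiemGeom

end

theorem mainTheorem8
    {E : Type*} [NormedAddCommGroup E] [NormedSpace ℝ E] [FiniteDimensional ℝ E]
    {H : Type*} [TopologicalSpace H] (I : ModelWithCorners ℝ E H) [I.Boundaryless]
    {M : Type*} [TopologicalSpace M] [ChartedSpace H M] [IsManifold I ∞ M]
    [T2Space M] [SecondCountableTopology M] [NoncompactSpace M]
    {E' : Type*} [NormedAddCommGroup E'] [NormedSpace ℝ E'] [FiniteDimensional ℝ E']
    {H' : Type*} [TopologicalSpace H'] (I' : ModelWithCorners ℝ E' H') [I'.Boundaryless]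
    {N : Type*} [TopologicalSpace N] [ChartedSpace H' N] [IsManifold I' ∞ N]
    [T2Space N] [SecondCountableTopology N]
    (h : RiemGeom.RMetric I' N) (hh_complete : RiemGeom.IsCompleteMetric h)
    (hh_curv : RiemGeom.CurvatureOperatorGE h 0)
    (g : RiemGeom.RMetric I M) (hg_complete : RiemGeom.IsCompleteMetric g)
    (f : ℝ → ℝ) (J : Set ℝ) (Φ : OpenPartialHomeomorph (ℝ × N) M)
    (hΦ : RiemGeom.IsWarpedProduct g h f J Φ)
    (hJ : (J = univ ∧ Φ.target = univ) ∨ (J = Ioi 0 ∧ ∃ o : M, Φ.target = {o}ᶜ))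
    (C : ℝ) (hC : 0 ≤ C)
    (hRic : ∀ r ∈ J, ∀ p : N,
      -C ^ 2 ≤ RiemGeom.ricci g (Φ (r, p))
        (RiemGeom.radial I I' Φ r p) (RiemGeom.radial I I' Φ r p)) :
    ∃ C' : ℝ, RiemGeom.CurvatureOperatorGE g (-C') := by
  -- `f'' ≤ k² f` for a constant `k`, unless `M` is one-dimensional
  have hk : Subsingleton E' ∨ ∃ k : ℝ, 0 ≤ k ∧
      (Nonempty N → ∀ r ∈ J, deriv (deriv f) r ≤ k ^ 2 * f r) := by
    have hJo : IsOpen J := by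
      rcases hJ with ⟨rfl, -⟩ | ⟨rfl, -⟩
      exacts [isOpen_univ, isOpen_Ioi]
    rcases Nat.eq_zero_or_pos (Module.finrank ℝ E') with hn | hn
    · exact Or.inl (Module.finrank_zero_iff.1 hn)
    · refine Or.inr ⟨√(C ^ 2 / Module.finrank ℝ E'), Real.sqrt_nonneg _, fun ⟨p⟩ r hr ↦ ?_⟩
      rw [Real.sq_sqrt (by positivity)]
      exact hΦ.deriv_deriv_le_of_ricci hJo hn hr p (hRic r hr p)
  have hN (p : N) : RiemGeom.CurvatureOperatorGEAt h p 0 := hh_curv p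
  have hmem : ∀ x ∈ Φ.target, ∃ r ∈ J, ∃ p, Φ (r, p) = x := fun x hx ↦ by
    have h1 := Φ.map_target hx
    rw [hΦ.source_eq] at h1
    exact ⟨_, h1.1, _, Φ.right_inv hx⟩
  rcases hJ with ⟨rfl, htarget⟩ | ⟨rfl, o, htarget⟩
  · have hx (x : M) := hmem x (htarget ▸ mem_univ x)
    rcases hk with hE' | ⟨k, hk0, hk⟩
    · refine ⟨0, fun x ↦ ?_⟩
      obtain ⟨r, hr, p, rfl⟩ := hx x
      exact hΦ.curvatureOperatorGEAt_of_subsingleton isOpen_univ hr p _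
    · refine ⟨k ^ 2, fun x ↦ ?_⟩
      obtain ⟨r, -, p, rfl⟩ := hx x
      exact hΦ.curvatureOperatorGEAt_of_univ hk0 (fun r ↦ hk ⟨p⟩ r (mem_univ r)) (hN p) r
  · obtain ⟨C₁, hC₁⟩ := RiemGeom.eventually_curvatureOperatorGEAt g o
    have ho := hC₁.self_of_nhds
    have hx (x : M) (hxo : x ≠ o) := hmem x (htarget ▸ hxo)
    rcases hk with hE' | ⟨k, hk0, hk⟩
    · refine ⟨C₁, fun x ↦ ?_⟩
      rcases eq_or_ne x o with rfl | hxo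
      · exact ho
      · obtain ⟨r, hr, p, rfl⟩ := hx x hxo
        exact hΦ.curvatureOperatorGEAt_of_subsingleton isOpen_Ioi hr p _
    · refine ⟨max C₁ (k ^ 2), fun x ↦ ?_⟩
      rcases eq_or_ne x o with rfl | hxo
      · exact ho.mono (neg_le_neg (le_max_left _ _))
      · obtain ⟨r, hr, p, rfl⟩ := hx x hxo
        exact hΦ.curvatureOperatorGEAt_of_Ioi hg_complete htarget hC₁ hk0 (hk ⟨p⟩) (hN p) hr
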